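/- **Conventions.** Categories are locally small, "complete" and "continuous" refer to small limits. A *directed set* is a nonempty set $P$ with a reflexive and transitive relation $\le$ such that any two elements have an upper bound. A map $h : Q \to P$ of directed sets (not necessarily monotone) is *cofinal* if for every $p \in P$ there is $q \in Q$ with $h(q') \ge p$ for all $q' \ge q$. A subset $Q \subseteq P$ is cofinal if every $p \in P$ satisfies $p \le q$ for some $q \in Q$. **Sketches.** A *limit sketch* is a category $\mathcal E$ with a class $\mathcal S$ of cones over small diagrams in $\mathcal E$. A *$\mathcal C$-valued model* is a functor $\mathcal E \to \mathcal C$ mapping the cones in $\mathcal S$ to limit cones; with all natural transformations these form the category $\mathrm{Mod}_{\mathcal C}(\mathcal S)$, and $\mathrm{Mod}(\mathcal S) := \mathrm{Mod}_{\mathbf{Set}}(\mathcal S)$. The sketch is *realized* if every representable functor $\mathrm{Hom}(A,-)$ is a model. A set-valued model is *small* if it is, in $\mathrm{Mod}(\mathcal S)$, a small colimit of representable models. **Topological space objects.** Let $\mathcal C$ be complete. A (net-based) topological space object in $\mathcal C$ is an object $X$ with a monomorphism $\iota : C(P,X) \hookrightarrow X^P \times X$ for every directed set $P$ such that: 1.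 (Constant nets) the diagonal $X \to X^P \times X$ factors through $C(P,X)$; 2. (Subnets) for every cofinal map $h : Q \to P$ the composite $C(P,X) \hookrightarrow X^P \times X \xrightarrow{X^h \times \mathrm{id}} X^Q \times X$ factors through $C(Q,X)$; 3. (Locality) for every $P$ and every family of cofinal maps $h_Q : R_Q \to Q$ indexed by the cofinal subsets $Q \subseteq P$, the projection $\bigl(\prod_Q C(R_Q,X)\bigr) \times_{\prod_Q (X^{R_Q} \times X)} (X^P \times X) \to X^P \times X$ factors through $C(P,X)$; 4. (Iterations) for every $P$ and every family $(Q_p)_{p \in P}$ of directed sets, the morphism $\bigl(\prod_{p} C(Q_p,X)\bigr) \times_{X^P} C(P,X) \to X^{P \times \prod_p Q_p} \times X$, given on generalized elements by $\bigl((x_{p,q})_q \to s_p\bigr)_p, \bigl((s_p)_p \to s\bigr) \mapsto \bigl((x_{p,f(p)})_{(p,f)}, s\bigr)$, factors through $C(P \times \prod_p Q_p, X)$ (product order). A morphism $(X,C) \to (Y,D)$ is a morphism $f : X \to Y$ such that for every $P$ the composite $C(P,X) \hookrightarrow X^P \times X \to Y^P \times Y$ factors through $D(P,Y)$. This defines the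 category $\mathrm{Top}(\mathcal C)$ with the forgetful functor $\mathrm{Top}(\mathcal C) \to \mathcal C$. A continuous functor $H : \mathcal C \to \mathcal D$ between complete categories induces $\mathrm{Top}(H) : \mathrm{Top}(\mathcal C) \to \mathrm{Top}(\mathcal D)$. **The sketch $\mathcal T$.** For a directed set $P$ let $P \cup \{\infty\}$ be the space in which every subset of $P$ is open and the sets $P_{\ge p} \cup \{\infty\}$ form a local base at $\infty$; $P \sqcup 1$ denotes the discrete space. Let $\mathcal E \subseteq \mathbf{Top}$ be the full subcategory, and $\mathcal S$ the class of cocones in $\mathcal E$, which consist exactly of 1. every discrete space $I$, with the coproduct cocone $(i : 1 \to I)_{i \in I}$; 2. the spaces $P \cup \{\infty\}$, with the epimorphism cocone of $P \sqcup 1 \to P \cup \{\infty\}$ (the square with two sides this map and two sides identities); 3. for every $P$ and every family of cofinal maps $h_Q : R_Q \to Q$ indexed by the cofinal subsets $Q \subseteq P$, the colimits $F(P,h)$, with all colimit cocones in $\mathbf{Top}$, of the diagram consisting of the spans $R_Q \cup \{\infty\} \leftarrow R_Q \sqcup 1 \to P \sqcup 1$ for all $Q$; 4. for every $P$ and every family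 $(Q_p)_{p \in P}$ of directed sets, the colimits $G(P,Q)$, with all colimit cocones in $\mathbf{Top}$, of the diagram consisting of the spans $Q_p \cup \{\infty\} \xleftarrow{\infty} 1 \xrightarrow{p} P \cup \{\infty\}$ for all $p \in P$. Let $\mathcal T := \mathcal S^{\mathrm{op}}$, a limit sketch on $\mathcal E^{\mathrm{op}}$. **Theorem.** 1. $\mathcal T$ is realized, and it is large: $\mathcal E^{\mathrm{op}}$ is not equivalent to a small category. 2. For every complete category $\mathcal C$ there is an equivalence of categories $\Phi_{\mathcal C} : \mathrm{Mod}_{\mathcal C}(\mathcal T) \simeq \mathrm{Top}(\mathcal C)$ together with a natural isomorphism $\eta_{\mathcal C}$ from the underlying object of $\Phi_{\mathcal C}(M)$ to $M(1)$. This is natural in $\mathcal C$: for every continuous functor $H : \mathcal C \to \mathcal D$ between complete categories there is an isomorphism $\mathrm{Top}(H) \circ \Phi_{\mathcal C} \cong \Phi_{\mathcal D} \circ (H \circ -)$ compatible with $\eta_{\mathcal C}$ and $\eta_{\mathcal D}$. 3. In particular, $\mathrm{Mod}(\mathcal T) \simeq \mathbf{Top}$, by an equivalence for which the underlying set of the space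 that corresponds to $M$ is naturally isomorphic to $M(1)$. 4. Every set-valued model of $\mathcal T$ is small. -/

import Mathlib

open CategoryTheory CategoryTheory.Limits Opposite

universe u v v' w w'

/-! ## Limit sketches, colimit sketches and their models -/

section Sketches

/-- A cone over a small diagram in a category. -/
structure SmallCone (E : Type w) [Category.{v} E] : Type (max w v (u + 1)) where
  /-- the index category -/
  J : Type u
  [cat : SmallCategory J]
  /-- the diagram -/
  K : J ⥤ E
  /-- the cone -/
  cone : Cone K

attribute [instance] SmallCone.cat

/-- A cocone under a small diagram in a category. -/
structure SmallCocone (E : Type w) [Category.{v} E] : Type (max w v (u + 1)) where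
  /-- the index category -/
  J : Type u
  [cat : SmallCategory J]
  /-- the diagram -/
  K : J ⥤ E
  /-- the cocone -/
  cocone : Cocone K

attribute [instance] SmallCocone.cat

/-- The cone in the opposite category that corresponds to a cocone. -/
def SmallCocone.op {E : Type w} [Category.{v} E] (s : SmallCocone.{u} E) : SmallCone.{u} Eᵒᵖ where
  J := s.Jᵒᵖ
  K := s.K.op
  cone := s.cocone.op

/-- A limit sketch on the category `E`: a class of small cones in `E`. -/
structure LimitSketch (E : Type w) [Category.{v} E] where
  /-- the distinguished cones -/
  cones : Set (SmallCone.{u} E)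

/-- A colimit sketch on the category `E`: a class of small cocones in `E`. -/
structure ColimitSketch (E : Type w) [Category.{v} E] where
  /-- the distinguished cocones -/
  cocones : Set (SmallCocone.{u} E)

/-- The limit sketch on `Eᵒᵖ` that is dual to a colimit sketch on `E`. -/
def ColimitSketch.op {E : Type w} [Category.{v} E] (S : ColimitSketch.{u} E) :
    LimitSketch.{u} Eᵒᵖ where
  cones := SmallCocone.op '' S.cocones

namespace LimitSketch

/-- A `C`-valued model of a limit sketch: a functor that maps the distinguished cones
to limit cones. -/
def IsModel {E : Type w} [Category.{v} E] (S : LimitSketch.{u} E)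
    (C : Type w') [Category.{v'} C] : ObjectProperty (E ⥤ C) :=
  fun M => ∀ s ∈ S.cones, Nonempty (IsLimit (M.mapCone s.cone))

/-- The category of `C`-valued models of a limit sketch, a full subcategory of the category of
functors. -/
abbrev Mod {E : Type w} [Category.{v} E] (S : LimitSketch.{u} E)
    (C : Type w') [Category.{v'} C] :=
  (S.IsModel C).FullSubcategory

/-- A limit sketch is realized when all representable functors are models. -/
def Realized {E : Type w} [Category.{v} E] (S : LimitSketch.{u} E) : Prop :=
  ∀ A : E, S.IsModel (Type v) (coyoneda.obj (op A))

/-- A set-valued model is small when it is a (small) colimit of representable models, the colimit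
being taken in the category of models. -/
def IsSmallModel {E : Type w} [Category.{u} E] (S : LimitSketch.{u} E) (M : S.Mod (Type u)) :
    Prop :=
  ∃ (J : Type u) (_ : SmallCategory J) (p : ColimitPresentation J M),
    ∀ j, (p.diag.obj j).obj.IsCorepresentable

/-- The functor that evaluates a model at an object of the sketch. -/
def evaluation {E : Type w} [Category.{v} E] (S : LimitSketch.{u} E) (A : E)
    (C : Type w') [Category.{v'} C] : S.Mod C ⥤ C :=
  (S.IsModel C).ι ⋙ (CategoryTheory.evaluation E C).obj A

/-- Composition of models with a functor that preserves (small) limits. -/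
def mapMod {E : Type w} [Category.{v} E] (S : LimitSketch.{u} E)
    {C : Type w'} [Category.{v'} C] {D : Type w'} [Category.{v'} D] (H : C ⥤ D)
    [PreservesLimitsOfSize.{u, u} H] : S.Mod C ⥤ S.Mod D :=
  (S.IsModel D).lift ((S.IsModel C).ι ⋙ (Functor.whiskeringRight E C D).obj H)
    (fun M s hs => (M.property s hs).map fun t =>
      (isLimitOfPreserves H t : IsLimit (H.mapCone (M.obj.mapCone s.cone))))

end LimitSketch

end Sketches

/-! ## Directed sets -/

section Directed

/-- A directed set: a nonempty set with a reflexive and transitive relation such that any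
two elements have an upper bound. -/
structure DirectedSet : Type (u + 1) where
  /-- the underlying set -/
  carrier : Type u
  [preorder : Preorder carrier]
  [directed : IsDirectedOrder carrier]
  [nonempty : Nonempty carrier]

instance : CoeSort DirectedSet.{u} (Type u) := ⟨DirectedSet.carrier⟩

attribute [instance] DirectedSet.preorder DirectedSet.directed DirectedSet.nonempty

/-- A map `h : Q → P`, not necessarily monotone, is cofinal when for every `p` there is some `q`
such that `h` maps all elements above `q` to elements above `p`. -/
def IsCofinalMap {Q P : Type u} [Preorder Q] [Preorder P] (h : Q → P) : Prop :=
  ∀ p : P, ∃ q : Q, ∀ q' : Q, q ≤ q' → p ≤ h q'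

/-- The directed set `P × ∏ p, Q p`, with the product order. -/
abbrev DirectedSet.iter (P : DirectedSet.{u}) (Q : P → DirectedSet.{u}) : DirectedSet.{u} where
  carrier := P × (∀ p, Q p)
  directed := ⟨fun a b => by
    obtain ⟨c, hac, hbc⟩ := exists_ge_ge a.1 b.1
    choose g hg using fun p => exists_ge_ge (a.2 p) (b.2 p)
    exact ⟨(c, g), ⟨hac, fun p => (hg p).1⟩, ⟨hbc, fun p => (hg p).2⟩⟩⟩

/-- The cofinal subsets of a directed set, which serve as an index set. -/
abbrev CofinalSubset (P : DirectedSet.{u}) : Type u := {Q : Set P // IsCofinal Q}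

end Directed

/-! ## Net-based topological space objects -/

section TopObj

variable {C : Type w} [Category.{u} C] [HasLimits C]

/-- The object `X ^ P × X`. -/
noncomputable abbrev netPow (X : C) (P : Type u) : C := (∏ᶜ fun _ : P => X) ⨯ X

/-- The component of index `p` of a net. -/
noncomputable abbrev netPow.term (X : C) {P : Type u} (p : P) : netPow X P ⟶ X :=
  prod.fst ≫ Pi.π (fun _ : P => X) p

/-- The limit point of a net. -/
noncomputable abbrev netPow.limit (X : C) (P : Type u) : netPow X P ⟶ X := prod.snd

/-- The morphism `f ^ P × f`. -/
noncomputable def netPow.map {X Y : C} (f : X ⟶ Y) (P : Type u) : netPow X P ⟶ netPow Y P :=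
  prod.map (Limits.Pi.map fun _ => f) f

/-- The morphism `X ^ h × id`. -/
noncomputable def netPow.reindex (X : C) {Q P : Type u} (h : Q → P) : netPow X P ⟶ netPow X Q :=
  prod.map (Pi.lift fun q => Pi.π (fun _ : P => X) (h q)) (𝟙 X)

variable (C) in
/-- A net-based topological space object in a complete category: an object `X` with a
monomorphism `ι P : C(P, X) ⟶ X ^ P × X` (the object of convergent nets with their limits) for every
directed set `P`, such that the following axioms hold. -/
structure TopObj : Type (max w (u + 1)) where
  /-- the underlying object -/
  X : C
  /-- the object of convergent `P`-indexed nets -/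
  conv : DirectedSet.{u} → C
  /-- the inclusion -/
  ι : ∀ P : DirectedSet.{u}, conv P ⟶ netPow X P
  mono_ι : ∀ P : DirectedSet.{u}, Mono (ι P)
  /-- Constant nets. -/
  const : ∀ P : DirectedSet.{u}, ∃ c : X ⟶ conv P,
    c ≫ ι P = prod.lift (Pi.lift fun _ => 𝟙 X) (𝟙 X)
  /-- Subnets. -/
  subnet : ∀ (P Q : DirectedSet.{u}) (h : Q → P), IsCofinalMap h →
    ∃ c : conv P ⟶ conv Q, c ≫ ι Q = ι P ≫ netPow.reindex X h
  /-- Locality: for every directed set `P` and every family of cofinal maps `h Q : R Q → Q`,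
  where `Q` runs through the cofinal subsets of `P`, the second projection of the fiber product of
  `∏ Q, C(R Q, X)` and `X ^ P × X` over `∏ Q, X ^ (R Q) × X` factors through `C(P, X)`. -/
  locality : ∀ (P : DirectedSet.{u}) (R : CofinalSubset P → DirectedSet.{u})
    (h : ∀ Q : CofinalSubset P, R Q → Q.1), (∀ Q, IsCofinalMap (h Q)) →
    ∃ c : pullback (Limits.Pi.map fun Q => ι (R Q))
        (Pi.lift fun Q => netPow.reindex X fun r : R Q => (h Q r : P)) ⟶ conv P,
      c ≫ ι P = pullback.snd _ _
  /-- Iterations: the fiber product of `∏ p, C(Q p, X)` and `C(P, X)` over `X ^ P` is the object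
  of families of convergent nets `x p → s p` and convergent nets `s → t`. The morphism to
  `X ^ (P × ∏ p, Q p) × X` which maps them to the net `(p, f) ↦ x p (f p)` and the point `t`
  factors through `C(P × ∏ p, Q p, X)`. -/
  iteration : ∀ (P : DirectedSet.{u}) (Q : P → DirectedSet.{u}),
    ∃ c : pullback (Limits.Pi.map fun p => ι (Q p) ≫ netPow.limit X (Q p))
        (ι P ≫ prod.fst) ⟶ conv (P.iter Q),
      c ≫ ι (P.iter Q) = prod.lift
        (Pi.lift fun a : P.iter Q => pullback.fst _ _ ≫ Pi.π _ a.1 ≫ ι (Q a.1) ≫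
          netPow.term X (a.2 a.1))
        (pullback.snd _ _ ≫ ι P ≫ netPow.limit X P)

attribute [instance] TopObj.mono_ι

namespace TopObj

/-- A morphism of topological space objects: a morphism of the underlying objects which
preserves the convergence of nets. -/
@[ext]
structure Hom (A B : TopObj C) where
  /-- the underlying morphism -/
  f : A.X ⟶ B.X
  preserves : ∀ P : DirectedSet.{u}, ∃ c : A.conv P ⟶ B.conv P,
    c ≫ B.ι P = A.ι P ≫ netPow.map f P

instance : Category (TopObj C) where
  Hom := Hom
  id A := ⟨𝟙 A.X, fun P => ⟨𝟙 _, by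
    apply prod.hom_ext
    · apply Pi.hom_ext; intro p; simp [netPow.map]
    · simp [netPow.map]⟩⟩
  comp F G := ⟨F.f ≫ G.f, fun P => by
    obtain ⟨c, hc⟩ := F.preserves P
    obtain ⟨d, hd⟩ := G.preserves P
    refine ⟨c ≫ d, ?_⟩
    rw [Category.assoc, hd, reassoc_of% hc]
    apply prod.hom_ext
    · apply Pi.hom_ext; intro p; simp [netPow.map]
    · simp [netPow.map]⟩
  id_comp F := Hom.ext (Category.id_comp F.f)
  comp_id F := Hom.ext (Category.comp_id F.f)
  assoc F G K := Hom.ext (Category.assoc F.f G.f K.f)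

variable (C) in
/-- The functor that maps a topological space object to its underlying object. -/
def forget : TopObj C ⥤ C where
  obj A := A.X
  map F := F.f

/-! ### Functoriality with respect to continuous functors -/

section Map

variable {D : Type w'} [Category.{u} D] [HasLimits D]

/-- The comparison morphism `H (X ^ P × X) ⟶ H X ^ P × H X`. -/
noncomputable def cmp (H : C ⥤ D) (X : C) (P : Type u) :
    H.obj (netPow X P) ⟶ netPow (H.obj X) P :=
  prod.lift (Pi.lift fun p => H.map (netPow.term X p)) (H.map (netPow.limit X P))

lemma lift_term {T X : C} {P : Type u} (f : P → (T ⟶ X)) (g : T ⟶ X) (p : P) :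
    prod.lift (Pi.lift f) g ≫ netPow.term X p = f p := by
  rw [netPow.term, prod.lift_fst_assoc, Pi.lift_π]

lemma lift_limit {T X : C} {P : Type u} (f : P → (T ⟶ X)) (g : T ⟶ X) :
    prod.lift (Pi.lift f) g ≫ netPow.limit X P = g := by
  rw [netPow.limit, prod.lift_snd]

lemma cmp_term (H : C ⥤ D) (X : C) (P : Type u) (p : P) :
    cmp H X P ≫ netPow.term (H.obj X) p = H.map (netPow.term X p) :=
  lift_term _ _ _

lemma cmp_limit (H : C ⥤ D) (X : C) (P : Type u) :
    cmp H X P ≫ netPow.limit (H.obj X) P = H.map (netPow.limit X P) :=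
  lift_limit _ _

lemma netPow_hom_ext {T X : C} {P : Type u} {a b : T ⟶ netPow X P}
    (h : ∀ p, a ≫ netPow.term X p = b ≫ netPow.term X p)
    (h' : a ≫ netPow.limit X P = b ≫ netPow.limit X P) : a = b := by
  apply prod.hom_ext
  · apply Pi.hom_ext; intro p; simpa [netPow.term] using h p
  · exact h'

lemma reindex_term (X : C) {Q P : Type u} (h : Q → P) (q : Q) :
    netPow.reindex X h ≫ netPow.term X q = netPow.term X (h q) := by
  simp [netPow.reindex, netPow.term]

lemma reindex_limit (X : C) {Q P : Type u} (h : Q → P) :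
    netPow.reindex X h ≫ netPow.limit X Q = netPow.limit X P := by
  simp [netPow.reindex, netPow.limit]

lemma map_term {X Y : C} (f : X ⟶ Y) (P : Type u) (p : P) :
    netPow.map f P ≫ netPow.term Y p = netPow.term X p ≫ f := by
  simp [netPow.map, netPow.term]

lemma map_limit {X Y : C} (f : X ⟶ Y) (P : Type u) :
    netPow.map f P ≫ netPow.limit Y P = netPow.limit X P ≫ f := by
  simp [netPow.map, netPow.limit]

lemma cmp_reindex (H : C ⥤ D) (X : C) {Q P : Type u} (h : Q → P) :
    H.map (netPow.reindex X h) ≫ cmp H X Q = cmp H X P ≫ netPow.reindex (H.obj X) h := by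
  apply netPow_hom_ext
  · intro q
    rw [Category.assoc, Category.assoc, cmp_term, reindex_term, cmp_term, ← H.map_comp,
      reindex_term]
  · rw [Category.assoc, Category.assoc, cmp_limit, reindex_limit, cmp_limit, ← H.map_comp,
      reindex_limit]

lemma cmp_map (H : C ⥤ D) {X Y : C} (f : X ⟶ Y) (P : Type u) :
    H.map (netPow.map f P) ≫ cmp H Y P = cmp H X P ≫ netPow.map (H.map f) P := by
  apply netPow_hom_ext
  · intro p
    rw [Category.assoc, Category.assoc, cmp_term, map_term, ← H.map_comp, map_term, H.map_comp,
      ← Category.assoc, cmp_term]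
  · rw [Category.assoc, Category.assoc, cmp_limit, map_limit, ← H.map_comp, map_limit, H.map_comp,
      ← Category.assoc, cmp_limit]

instance isIso_cmp (H : C ⥤ D) [PreservesLimits H] (X : C) (P : Type u) : IsIso (cmp H X P) := by
  have : cmp H X P = prodComparison H (∏ᶜ fun _ : P => X) X ≫
      prod.map (piComparison H fun _ : P => X) (𝟙 (H.obj X)) := by
    apply netPow_hom_ext
    · intro p; rw [cmp_term]; simp [netPow.term]
    · rw [cmp_limit]; simp [netPow.limit]
  rw [this]
  infer_instance

lemma locality_aux (H : C ⥤ D) [PreservesLimits H] (A : TopObj C) (P : DirectedSet.{u})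
    (R : CofinalSubset P → DirectedSet.{u}) (h : ∀ Q : CofinalSubset P, R Q → Q.1)
    (hh : ∀ Q, IsCofinalMap (h Q)) {T : D} (y : ∀ Q, T ⟶ H.obj (A.conv (R Q)))
    (z : T ⟶ H.obj (netPow A.X P))
    (e : ∀ Q, y Q ≫ H.map (A.ι (R Q)) =
      z ≫ H.map (netPow.reindex A.X fun r : R Q => (h Q r : P))) :
    ∃ c : T ⟶ H.obj (A.conv P), c ≫ H.map (A.ι P) = z := by
  obtain ⟨c, hc⟩ := A.locality P R h hh
  have sq := (IsPullback.of_hasPullback (Limits.Pi.map fun Q => A.ι (R Q))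
    (Pi.lift fun Q => netPow.reindex A.X fun r : R Q => (h Q r : P))).map H
  have e1 : ∀ Q, (Pi.lift y ≫ inv (piComparison H fun Q => A.conv (R Q))) ≫
      H.map (Pi.π (fun Q => A.conv (R Q)) Q) = y Q := by
    intro Q
    rw [Category.assoc, ← piComparison_comp_π, IsIso.inv_hom_id_assoc, Pi.lift_π]
  have e2 : (Pi.lift y ≫ inv (piComparison H fun Q => A.conv (R Q))) ≫
      H.map (Limits.Pi.map fun Q => A.ι (R Q)) = z ≫ H.map
        (Pi.lift fun Q => netPow.reindex A.X fun r : R Q => (h Q r : P)) := by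
    rw [← cancel_mono (piComparison H _)]
    apply Pi.hom_ext
    intro Q
    rw [Category.assoc _ _ (Pi.π _ Q), Category.assoc _ _ (Pi.π _ Q), piComparison_comp_π,
      Category.assoc _ _ (H.map _), Category.assoc _ _ (H.map _),
      ← H.map_comp, ← H.map_comp, Limits.Pi.map_π, Pi.lift_π, H.map_comp, ← Category.assoc,
      e1, e]
  refine ⟨sq.lift _ _ e2 ≫ H.map c, ?_⟩
  rw [Category.assoc, ← H.map_comp, hc, sq.lift_snd]

lemma iteration_aux (H : C ⥤ D) [PreservesLimits H] (A : TopObj C) (P : DirectedSet.{u})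
    (Q : P → DirectedSet.{u}) {T : D} (y : ∀ p, T ⟶ H.obj (A.conv (Q p)))
    (z : T ⟶ H.obj (A.conv P))
    (e : ∀ p, y p ≫ H.map (A.ι (Q p) ≫ netPow.limit A.X (Q p)) =
      z ≫ H.map (A.ι P ≫ netPow.term A.X p)) :
    ∃ c : T ⟶ H.obj (A.conv (P.iter Q)),
      (∀ a : P.iter Q, c ≫ H.map (A.ι (P.iter Q) ≫ netPow.term A.X a) =
        y a.1 ≫ H.map (A.ι (Q a.1) ≫ netPow.term A.X (a.2 a.1))) ∧
      c ≫ H.map (A.ι (P.iter Q) ≫ netPow.limit A.X (P.iter Q)) =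
        z ≫ H.map (A.ι P ≫ netPow.limit A.X P) := by
  obtain ⟨c, hc⟩ := A.iteration P Q
  have sq := (IsPullback.of_hasPullback
    (Limits.Pi.map fun p => A.ι (Q p) ≫ netPow.limit A.X (Q p)) (A.ι P ≫ prod.fst)).map H
  have e1 : ∀ p, (Pi.lift y ≫ inv (piComparison H fun p => A.conv (Q p))) ≫
      H.map (Pi.π (fun p => A.conv (Q p)) p) = y p := by
    intro p
    rw [Category.assoc, ← piComparison_comp_π, IsIso.inv_hom_id_assoc, Pi.lift_π]
  have e2 : (Pi.lift y ≫ inv (piComparison H fun p => A.conv (Q p))) ≫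
      H.map (Limits.Pi.map fun p => A.ι (Q p) ≫ netPow.limit A.X (Q p)) =
        z ≫ H.map (A.ι P ≫ prod.fst) := by
    rw [← cancel_mono (piComparison H _)]
    apply Pi.hom_ext
    intro p
    rw [Category.assoc _ _ (Pi.π _ p), Category.assoc _ _ (Pi.π _ p), piComparison_comp_π,
      Category.assoc _ _ (H.map _), Category.assoc _ _ (H.map _),
      ← H.map_comp, ← H.map_comp, Limits.Pi.map_π, H.map_comp, ← Category.assoc, e1, e,
      Category.assoc]
  obtain ⟨l, hl1, hl2⟩ : ∃ l, l ≫ H.map (pullback.fst _ _) = _ ∧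
    l ≫ H.map (pullback.snd _ _) = _ := ⟨sq.lift _ _ e2, sq.lift_fst _ _ e2, sq.lift_snd _ _ e2⟩
  refine ⟨l ≫ H.map c, fun a => ?_, ?_⟩
  · rw [Category.assoc, ← H.map_comp, reassoc_of% hc, lift_term, H.map_comp, ← Category.assoc,
      hl1, H.map_comp, ← Category.assoc, e1]
  · rw [Category.assoc, ← H.map_comp, reassoc_of% hc, lift_limit, H.map_comp, ← Category.assoc,
      hl2]

/-- The image of a topological space object under a continuous functor `H`: the underlying object
is `H X`, and the objects of convergent nets are `H (C(P, X))`. -/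
noncomputable def mapObj (H : C ⥤ D) [PreservesLimits H] (A : TopObj C) : TopObj D where
  X := H.obj A.X
  conv P := H.obj (A.conv P)
  ι P := H.map (A.ι P) ≫ cmp H A.X P
  mono_ι P := inferInstance
  const P := by
    obtain ⟨c, hc⟩ := A.const P
    refine ⟨H.map c, ?_⟩
    rw [← Category.assoc, ← H.map_comp, hc]
    apply netPow_hom_ext
    · intro p
      rw [Category.assoc, cmp_term, ← H.map_comp, lift_term, lift_term, H.map_id]
    · rw [Category.assoc, cmp_limit, ← H.map_comp, lift_limit, lift_limit, H.map_id]
  subnet P Q h hh := by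
    obtain ⟨c, hc⟩ := A.subnet P Q h hh
    refine ⟨H.map c, ?_⟩
    rw [← Category.assoc, ← H.map_comp, hc, H.map_comp, Category.assoc, Category.assoc,
      cmp_reindex]
  locality P R h hh := by
    have e := pullback.condition
      (f := Limits.Pi.map fun Q => H.map (A.ι (R Q)) ≫ cmp H A.X (R Q))
      (g := Pi.lift fun Q => netPow.reindex (H.obj A.X) fun r : R Q => (h Q r : P))
    obtain ⟨c, hc⟩ := locality_aux H A P R h hh (T := pullback
        (Limits.Pi.map fun Q => H.map (A.ι (R Q)) ≫ cmp H A.X (R Q))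
        (Pi.lift fun Q => netPow.reindex (H.obj A.X) fun r : R Q => (h Q r : P)))
      (fun Q => pullback.fst _ _ ≫ Pi.π (fun Q => H.obj (A.conv (R Q))) Q)
      (pullback.snd _ _ ≫ inv (cmp H A.X P)) (fun Q => by
        have e' := e =≫ Pi.π _ Q
        rw [Category.assoc, Category.assoc, Limits.Pi.map_π, Pi.lift_π] at e'
        rw [← cancel_mono (cmp H A.X (R Q)), Category.assoc, Category.assoc, e', Category.assoc,
          Category.assoc, cmp_reindex, IsIso.inv_hom_id_assoc])
    refine ⟨c, ?_⟩
    rw [← Category.assoc, hc, Category.assoc, IsIso.inv_hom_id, Category.comp_id]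
  iteration P Q := by
    have e := pullback.condition
      (f := Limits.Pi.map fun p => (H.map (A.ι (Q p)) ≫ cmp H A.X (Q p)) ≫
        netPow.limit (H.obj A.X) (Q p))
      (g := (H.map (A.ι P) ≫ cmp H A.X P) ≫ prod.fst)
    obtain ⟨c, hc, hc'⟩ := iteration_aux H A P Q (T := pullback
        (Limits.Pi.map fun p => (H.map (A.ι (Q p)) ≫ cmp H A.X (Q p)) ≫
          netPow.limit (H.obj A.X) (Q p)) ((H.map (A.ι P) ≫ cmp H A.X P) ≫ prod.fst))
      (fun p => pullback.fst _ _ ≫ Pi.π (fun p => H.obj (A.conv (Q p))) p)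
      (pullback.snd _ _) (fun p => by
        have e' := e =≫ Pi.π _ p
        simp only [Category.assoc, Limits.Pi.map_π, cmp_limit, cmp_term] at e'
        simpa only [Category.assoc, H.map_comp] using e')
    refine ⟨c, ?_⟩
    apply netPow_hom_ext
    · intro a
      have := hc a
      rw [H.map_comp, H.map_comp (A.ι (Q a.1))] at this
      simp only [lift_term, Category.assoc, cmp_term]
      simpa only [Category.assoc] using this
    · rw [H.map_comp, H.map_comp] at hc'
      simp only [lift_limit, Category.assoc, cmp_limit]
      exact hc'

/-- The functor between categories of topological space objects that is induced by a continuous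
functor. -/
noncomputable def map (H : C ⥤ D) [PreservesLimits H] : TopObj C ⥤ TopObj D where
  obj A := mapObj H A
  map {A B} F := ⟨H.map F.f, fun P => by
    obtain ⟨c, hc⟩ := F.preserves P
    have e : H.map c ≫ H.map (B.ι P) ≫ cmp H B.X P =
        (H.map (A.ι P) ≫ cmp H A.X P) ≫ netPow.map (H.map F.f) P := by
      rw [← H.map_comp_assoc, hc, H.map_comp, Category.assoc, Category.assoc, cmp_map]
    exact ⟨H.map c, e⟩⟩
  map_id A := Hom.ext (H.map_id A.X)
  map_comp F G := Hom.ext (H.map_comp F.f G.f)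

end Map

end TopObj

end TopObj

/-! ## The limit sketch of topological spaces -/

section Sketch

/-- The space `P ∪ {∞}` (where `∞` is `none`): a set is open if it does not contain `∞`
or if it contains all elements of `P` above some `p`. So all subsets of `P` are open and the sets
`{q | p ≤ q} ∪ {∞}` form a local base at `∞`. -/
def DirectedSet.withInfty (P : DirectedSet.{u}) : TopCat.{u} :=
  @TopCat.of (Option P)
    { IsOpen := fun U => none ∈ U → ∃ p : P, ∀ q, p ≤ q → some q ∈ U
      isOpen_univ := fun _ => ⟨Classical.arbitrary P, fun _ _ => trivial⟩
      isOpen_inter := fun U V hU hV h => by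
        obtain ⟨p, hp⟩ := hU h.1
        obtain ⟨q, hq⟩ := hV h.2
        obtain ⟨r, hpr, hqr⟩ := exists_ge_ge p q
        exact ⟨r, fun s hs => ⟨hp s (hpr.trans hs), hq s (hqr.trans hs)⟩⟩
      isOpen_sUnion := fun F hF h => by
        obtain ⟨U, hU, hn⟩ := h
        obtain ⟨p, hp⟩ := hF U hU hn
        exact ⟨p, fun q hq => ⟨U, hU, hp q hq⟩⟩ }

/-- The continuous map on a discrete space that is given by a map of sets. -/
def fromDiscrete {I : Type u} {X : TopCat.{u}} (f : I → X) : TopCat.discrete.obj I ⟶ X :=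
  TopCat.ofHom (X := TopCat.discrete.obj I) ⟨f, continuous_of_discreteTopology⟩

/-- The bijective continuous map `P ⊔ 1 ⟶ P ∪ {∞}`, where `P ⊔ 1` is discrete. -/
def DirectedSet.toWithInfty (P : DirectedSet.{u}) :
    TopCat.discrete.obj (Option P) ⟶ P.withInfty :=
  fromDiscrete (X := P.withInfty) fun x => x

/-- The diagram which consists of the spans `R Q ∪ {∞} ⟵ R Q ⊔ 1 ⟶ P ⊔ 1`, where `Q` runs through
all cofinal subsets of `P`. The right morphism is induced by `h Q : R Q → Q`. -/
def localityDiagram (P : DirectedSet.{u}) (R : CofinalSubset P → DirectedSet.{u})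
    (h : ∀ Q : CofinalSubset P, R Q → Q.1) :
    WalkingMultispan (MultispanShape.mk (L := CofinalSubset P) (R := Option (CofinalSubset P))
      some fun _ => none) ⥤ TopCat.{u} :=
  MultispanIndex.multispan
    { left := fun Q => TopCat.discrete.obj (Option (R Q))
      right := fun b => match b with
        | some Q => (R Q).withInfty
        | none => TopCat.discrete.obj (Option P)
      fst := fun Q => (R Q).toWithInfty
      snd := fun Q => fromDiscrete (X := TopCat.discrete.obj (Option P))
        (Option.map fun r => (h Q r : P)) }

/-- The diagram which consists of the spans `Q p ∪ {∞} ⟵ 1 ⟶ P ∪ {∞}`, where `p` runs through all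
elements of `P`. The left morphism is the point `∞`, the right morphism is the point `p`. -/
def iterationDiagram (P : DirectedSet.{u}) (Q : P → DirectedSet.{u}) :
    WalkingMultispan (MultispanShape.mk (L := P) (R := Option P)
      some fun _ => none) ⥤ TopCat.{u} :=
  MultispanIndex.multispan
    { left := fun _ => TopCat.discrete.obj PUnit
      right := fun b => match b with
        | some p => (Q p).withInfty
        | none => P.withInfty
      fst := fun p => fromDiscrete (X := (Q p).withInfty) fun _ => (none : Option (Q p))
      snd := fun p => fromDiscrete (X := P.withInfty) fun _ => (some p : Option P) }

/-- The objects of the sketch: discrete spaces, the spaces `P ∪ {∞}`, and the colimits of the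
locality diagrams and of the iteration diagrams. -/
inductive IsSketchSpace : ObjectProperty TopCat.{u}
  | discrete (I : Type u) : IsSketchSpace (TopCat.discrete.obj I)
  | withInfty (P : DirectedSet.{u}) : IsSketchSpace P.withInfty
  | locality (P : DirectedSet.{u}) (R : CofinalSubset P → DirectedSet.{u})
      (h : ∀ Q : CofinalSubset P, R Q → Q.1) (hh : ∀ Q, IsCofinalMap (h Q))
      (c : Cocone (localityDiagram P R h)) (hc : IsColimit c) : IsSketchSpace c.pt
  | iteration (P : DirectedSet.{u}) (Q : P → DirectedSet.{u})
      (c : Cocone (iterationDiagram P Q)) (hc : IsColimit c) : IsSketchSpace c.pt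

/-- The underlying category of the sketch, a full subcategory of the category of spaces. -/
abbrev SketchSpace := IsSketchSpace.{u}.FullSubcategory

namespace SketchSpace

/-- A discrete space as an object of the sketch. -/
def discrete (I : Type u) : SketchSpace.{u} := ⟨TopCat.discrete.obj I, .discrete I⟩

/-- The one-point space as an object of the sketch. -/
def one : SketchSpace.{u} := discrete PUnit

/-- The space `P ∪ {∞}` as an object of the sketch. -/
def withInfty (P : DirectedSet.{u}) : SketchSpace.{u} := ⟨P.withInfty, .withInfty P⟩

/-- A point of a discrete space. -/
def point {I : Type u} (i : I) : one.{u} ⟶ discrete I :=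
  ObjectProperty.homMk (fromDiscrete (X := TopCat.discrete.obj I) fun _ => i)

/-- The canonical morphism `P ⊔ 1 ⟶ P ∪ {∞}` in the sketch. -/
def toWithInfty (P : DirectedSet.{u}) : discrete (Option P) ⟶ withInfty P :=
  ObjectProperty.homMk P.toWithInfty

end SketchSpace

lemma localityDiagram_mem (P : DirectedSet.{u}) (R : CofinalSubset P → DirectedSet.{u})
    (h : ∀ Q : CofinalSubset P, R Q → Q.1) (x) : IsSketchSpace ((localityDiagram P R h).obj x) := by
  obtain Q | (_ | Q) := x
  · exact .discrete _
  · exact .discrete _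
  · exact .withInfty _

lemma iterationDiagram_mem (P : DirectedSet.{u}) (Q : P → DirectedSet.{u}) (x) :
    IsSketchSpace ((iterationDiagram P Q).obj x) := by
  obtain p | (_ | p) := x
  · exact .discrete _
  · exact .withInfty _
  · exact .withInfty _

/-- The diagram of the epimorphism cocone of a morphism `f : Y ⟶ X`: two copies of `X`,
and two copies of `f` with the same domain `Y`. -/
def epiIndex {E : Type w} [Category.{v} E] {Y X : E} (f : Y ⟶ X) :
    MultispanIndex (MultispanShape.mk (L := PUnit.{u + 1}) (R := ULift.{u} Bool)
      (fun _ => ⟨false⟩) fun _ => ⟨true⟩) E where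
  left _ := Y
  right _ := X
  fst _ := f
  snd _ := f

/-- The epimorphism cocone of a morphism `f : Y ⟶ X`: the commutative square with two
sides `f` and two sides `𝟙 X`, which is a pushout if and only if `f` is an epimorphism. -/
def epiCocone {E : Type w} [Category.{v} E] {Y X : E} (f : Y ⟶ X) :
    Cocone (epiIndex.{u} f).multispan :=
  Multicofork.ofπ (epiIndex.{u} f) X (fun _ => 𝟙 X) fun _ => rfl

/-- The distinguished cocones in the category of sketch spaces. -/
inductive IsDistinguished : SmallCocone.{u} SketchSpace.{u} → Prop
  /-- The coproduct cocone `(i : 1 ⟶ I)` of a discrete space `I`. -/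
  | discrete (I : Type u) : IsDistinguished
      { J := Discrete I
        K := Discrete.functor fun _ => SketchSpace.one
        cocone := Cofan.mk (SketchSpace.discrete I) SketchSpace.point }
  /-- The epimorphism cocone of `P ⊔ 1 ⟶ P ∪ {∞}`. -/
  | withInfty (P : DirectedSet.{u}) : IsDistinguished
      { J := _
        K := _
        cocone := epiCocone (SketchSpace.toWithInfty P) }
  /-- All colimit cocones (in the category of spaces) of the locality diagrams. -/
  | locality (P : DirectedSet.{u}) (R : CofinalSubset P → DirectedSet.{u})
      (h : ∀ Q : CofinalSubset P, R Q → Q.1) (hh : ∀ Q, IsCofinalMap (h Q))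
      (c : Cocone (IsSketchSpace.lift (localityDiagram P R h) (localityDiagram_mem P R h)))
      (hc : IsColimit (IsSketchSpace.ι.mapCocone c)) : IsDistinguished
      { J := _
        K := _
        cocone := c }
  /-- All colimit cocones (in the category of spaces) of the iteration diagrams. -/
  | iteration (P : DirectedSet.{u}) (Q : P → DirectedSet.{u})
      (c : Cocone (IsSketchSpace.lift (iterationDiagram P Q) (iterationDiagram_mem P Q)))
      (hc : IsColimit (IsSketchSpace.ι.mapCocone c)) : IsDistinguished
      { J := _
        K := _
        cocone := c }

/-- The colimit sketch of net convergence. -/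
def netSketch : ColimitSketch.{u} SketchSpace.{u} where
  cocones := {s | IsDistinguished s}

/-- The limit sketch of topological spaces. -/
def topSketch : LimitSketch.{u} SketchSpace.{u}ᵒᵖ := netSketch.op

end Sketch

/-!
The theorem rests on Kelley's characterization of net convergence: a class of pairs of nets and
points in a set which satisfies the axioms on constant nets, subnets, locality and iterations
consists of the convergent nets of a topology (`ConvergenceClass.conv_iff_tendsto`).

For a topological space object `X` in `C` and an object `T`, the generalized elements `T ⟶ X` form
a convergence class, hence a topological space that is contravariant in `T` (`TopObj.elements`).
For a sketch space `A`, the presheaf of continuous maps from `A` to these spaces is representable: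
for the one-point space by `X`, for `P ∪ {∞}` by the object of convergent nets, and the other sketch
spaces are colimits of these, so that their presheaves are limits of representable presheaves
(`TopObj.elementsNerve_mem`). The representing objects form a model (`TopObj.toFunctor`), because
continuous maps out of a colimit form a limit.

Conversely, a model `M` has the topological space object with the underlying object `M(1)` and
the objects `M(P ∪ {∞})` of convergent nets (`modToTopObj`). The four axioms say that certain nets
converge in sketch spaces, and these converge since the axioms hold in all topological spaces.
The main tool is induction on sketch spaces (`SketchSpace.induction`). It shows that `M(A)` embeds
into a power of `M(1)` (`LimitSketch.IsModel.hom_ext`), and that a morphism `M(1) ⟶ N(1)` extends to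
a natural transformation if it does so on the spaces `P ∪ {∞}`. Hence `modToTopObj` is
fully faithful, and by the first construction it is essentially surjective. It is natural in `C`,
because a continuous functor commutes with the products that define the objects of nets.

For set-valued models, every model is the functor of continuous maps to a space (`topNerve`),
namely to the space of generalized elements with a singleton as domain. Every space is a small
colimit of one-point spaces and spaces `P ∪ {∞}`, where `P` is the directed set of neighborhoods of
a point (`NhdsSpaceOver.presentation`), and `topNerve` preserves this colimit, since it is an
equivalence. This shows that all set-valued models are small.
-/

/-! ### Convergence classes of nets -/

section Convergence

open Filter Topology

/-- A cofinal subset of a directed set, as a directed set. -/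
abbrev CofinalSubset.toDirectedSet {P : DirectedSet.{u}} (Q : CofinalSubset P) :
    DirectedSet.{u} where
  carrier := Q.1
  directed := ⟨fun a b => by
    obtain ⟨c, hac, hbc⟩ := exists_ge_ge (a : P) b
    obtain ⟨d, hd, hcd⟩ := Q.2 c
    exact ⟨⟨d, hd⟩, hac.trans hcd, hbc.trans hcd⟩⟩
  nonempty := by
    obtain ⟨d, hd, -⟩ := Q.2 (Classical.arbitrary P)
    exact ⟨⟨d, hd⟩⟩

lemma CofinalSubset.isCofinalMap_val {P : DirectedSet.{u}} (Q : CofinalSubset P) :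
    IsCofinalMap (Subtype.val : Q.toDirectedSet → P) := fun p => by
  obtain ⟨d, hd, hpd⟩ := Q.2 p
  exact ⟨⟨d, hd⟩, fun q' hq' => hpd.trans hq'⟩

lemma IsCofinalMap.tendsto {Q P : DirectedSet.{u}} {h : Q → P} (hh : IsCofinalMap h) :
    Tendsto h atTop atTop :=
  tendsto_atTop.2 fun p => by
    obtain ⟨q, hq⟩ := hh p
    exact (eventually_ge_atTop q).mono hq

/-- A class of pairs of nets and points in a set which satisfies Kelley's axioms
(constant nets, subnets, locality, iterations). -/
structure ConvergenceClass (S : Type u) where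
  /-- the net converges to the point -/
  conv : ∀ P : DirectedSet.{u}, (P → S) → S → Prop
  const : ∀ (P : DirectedSet.{u}) (s : S), conv P (fun _ => s) s
  subnet : ∀ (P Q : DirectedSet.{u}) (h : Q → P), IsCofinalMap h → ∀ (x : P → S) (s : S),
    conv P x s → conv Q (x ∘ h) s
  locality : ∀ (P : DirectedSet.{u}) (R : CofinalSubset P → DirectedSet.{u})
    (h : ∀ Q : CofinalSubset P, R Q → Q.1), (∀ Q, IsCofinalMap (h Q)) → ∀ (x : P → S) (s : S),
    (∀ Q, conv (R Q) (fun r => x (h Q r)) s) → conv P x s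
  iteration : ∀ (P : DirectedSet.{u}) (Q : P → DirectedSet.{u}) (x : ∀ p, Q p → S) (y : P → S)
    (s : S), (∀ p, conv (Q p) (x p) (y p)) → conv P y s →
      conv (P.iter Q) (fun a => x a.1 (a.2 a.1)) s

namespace ConvergenceClass

variable {S : Type u} (K : ConvergenceClass S)

/-- The topology of a convergence class: a set is open if all nets in the class that converge to
a point of the set are eventually in the set. -/
abbrev topology : TopologicalSpace S where
  IsOpen U := ∀ (P : DirectedSet.{u}) (x : P → S) (s : S), K.conv P x s → s ∈ U →
    ∀ᶠ p in atTop, x p ∈ U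
  isOpen_univ _ _ _ _ _ := Eventually.of_forall fun _ => trivial
  isOpen_inter _ _ hU hV P x s hx hs := (hU P x s hx hs.1).and (hV P x s hx hs.2)
  isOpen_sUnion _ hF P x s hx := fun ⟨U, hU, hs⟩ =>
    (hF U hU P x s hx hs).mono fun _ hp => ⟨U, hU, hp⟩

/-- A point of the closure of a set is the limit of a net in the set. Indeed, the limits of nets in
the set form a closed set because of the axiom on iterations. -/
lemma exists_net_of_mem_closure {A : Set S} {s : S} (hs : s ∈ closure[K.topology] A) :
    ∃ (P : DirectedSet.{u}) (x : P → S), (∀ p, x p ∈ A) ∧ K.conv P x s := by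
  let _ := K.topology
  suffices h : IsClosed {s | ∃ (P : DirectedSet.{u}) (x : P → S), (∀ p, x p ∈ A) ∧ K.conv P x s} by
    refine closure_minimal (fun a ha => ?_) h hs
    exact ⟨⟨PUnit⟩, fun _ => a, fun _ => ha, K.const _ a⟩
  constructor
  intro P y t hy ht
  by_contra hn
  -- The terms of the net `y` which are limits of nets in `A` have cofinal indices.
  have hc : IsCofinal {p : P | ∃ (D : DirectedSet.{u}) (x : D → S), (∀ d, x d ∈ A) ∧
      K.conv D x (y p)} := fun p => by
    by_contra! hp
    refine hn ((eventually_ge_atTop p).mono fun q hq hq' => hp q hq' hq)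
  let Q : CofinalSubset P := ⟨_, hc⟩
  choose D x hx hxy using fun q : Q.toDirectedSet => q.2
  exact ht ⟨Q.toDirectedSet.iter D, _, fun a => hx _ _, K.iteration Q.toDirectedSet D x
    (fun q => y q) t hxy (K.subnet P _ _ Q.isCofinalMap_val y t hy)⟩

/-- Kelley's theorem: the nets in a convergence class are exactly the convergent nets
of its topology. -/
theorem conv_iff_tendsto {P : DirectedSet.{u}} {x : P → S} {s : S} :
    K.conv P x s ↔ Tendsto x atTop (@nhds S K.topology s) := by
  let _ := K.topology
  refine ⟨fun hx => tendsto_nhds.2 fun U hU hs => hU P x s hx hs, fun hx => ?_⟩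
  -- By locality, a net in the class is needed that refines the restriction to a cofinal set `Q`.
  -- It is an iteration: `s` is in the closure of each tail of the restriction, hence the limit of
  -- a net in each tail, and these nets are indexed by the elements of `Q`.
  have key : ∀ Q : CofinalSubset P, ∃ (R : DirectedSet.{u}) (h : R → Q.1), IsCofinalMap h ∧
      K.conv R (fun r => x (h r)) s := fun Q => by
    have hQ : ∀ q : Q.toDirectedSet, ∃ (D : DirectedSet.{u}) (y : D → Q.1),
        (∀ d, q ≤ y d) ∧ K.conv D (fun d => x (y d)) s := fun q => by
      have := Q.toDirectedSet.directed
      have := Q.toDirectedSet.nonempty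
      have hcl : s ∈ closure ((fun q' : Q.1 => x q') '' Set.Ici q) :=
        mem_closure_of_tendsto (hx.comp Q.isCofinalMap_val.tendsto)
          ((eventually_ge_atTop q).mono fun q' hq' => ⟨q', hq', rfl⟩)
      obtain ⟨D, z, hz, hzs⟩ := K.exists_net_of_mem_closure hcl
      choose y hy hyz using hz
      obtain rfl : (fun d => x (y d)) = z := funext hyz
      exact ⟨D, y, hy, hzs⟩
    choose D y hy hys using hQ
    refine ⟨Q.toDirectedSet.iter D, fun a => y a.1 (a.2 a.1), fun q => ?_, ?_⟩
    · exact ⟨(q, Classical.arbitrary _), fun a ha => ha.1.trans (hy _ _)⟩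
    · exact K.iteration Q.toDirectedSet D (fun q d => x (y q d)) (fun _ => s) s hys (K.const _ s)
  choose R h hh hx using key
  exact K.locality P R h hh x s hx

end ConvergenceClass

/-- The convergent nets in a topological space form a convergence class. -/
def ConvergenceClass.ofTopologicalSpace (Y : Type u) [TopologicalSpace Y] :
    ConvergenceClass Y where
  conv _ x s := Tendsto x atTop (𝓝 s)
  const _ _ := tendsto_const_nhds
  subnet _ _ _ hh _ _ hx := hx.comp hh.tendsto
  locality P R h hh x s hx := by
    by_contra hn
    obtain ⟨U, hU, hn⟩ := not_tendsto_iff_exists_frequently_notMem.1 hn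
    -- The terms of the net outside of some neighborhood `U` have cofinal indices.
    let Q : CofinalSubset P := ⟨{p | x p ∉ U}, fun p => by
      obtain ⟨q, hq, hq'⟩ := (frequently_atTop.1 hn) p
      exact ⟨q, hq', hq⟩⟩
    obtain ⟨r, hr⟩ := ((hx Q).eventually_mem hU).exists
    exact (h Q r).2 hr
  iteration P Q x y s hx hy := by
    refine tendsto_nhds.2 fun U hU hs => ?_
    obtain ⟨p₀, hp₀⟩ := eventually_atTop.1 (hy.eventually_mem (hU.mem_nhds hs))
    have hq : ∀ p, ∃ q, p₀ ≤ p → ∀ q', q ≤ q' → x p q' ∈ U := fun p => by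
      by_cases hp : p₀ ≤ p
      · obtain ⟨q, hq⟩ := eventually_atTop.1 ((hx p).eventually_mem (hU.mem_nhds (hp₀ p hp)))
        exact ⟨q, fun _ => hq⟩
      · exact ⟨Classical.arbitrary _, fun h => absurd h hp⟩
    choose f hf using hq
    exact (eventually_ge_atTop (⟨p₀, f⟩ : P.iter Q)).mono fun a ha => hf _ ha.1 _ (ha.2 _)

/-! ### The spaces `P ∪ {∞}` -/

namespace DirectedSet

variable {P : DirectedSet.{u}}

/-- An element of `P` as a point of `P ∪ {∞}`. -/
def term (p : P) : P.withInfty := (some p : Option P)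

/-- The point `∞` of `P ∪ {∞}`. -/
def infty : P.withInfty := (none : Option P)

/-- The map on `P ∪ {∞}` that is given by a net and a value at `∞`. -/
def extend {α : Sort*} (x : P → α) (s : α) : P.withInfty → α := fun a : Option P => a.elim s x

@[elab_as_elim]
lemma withInfty_cases {motive : P.withInfty → Prop} (term : ∀ p : P, motive (term p))
    (infty : motive infty) (a : P.withInfty) : motive a :=
  match a with
  | none => infty
  | some p => term p

lemma extend_eta {α : Sort*} (f : P.withInfty → α) :
    extend (fun p => f (term p)) (f infty) = f := by
  funext a
  cases a using withInfty_cases <;> rfl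

/-- A map on `P ∪ {∞}` is continuous if and only if its value at `∞` is a limit of the net
of its other values. -/
lemma continuous_withInfty_iff {Y : Type u} [TopologicalSpace Y]
    {f : P.withInfty → Y} :
    Continuous f ↔ Tendsto (fun p : P => f (term p)) atTop (𝓝 (f infty)) := by
  rw [continuous_def, tendsto_nhds]
  refine forall₂_congr fun U _ => ?_
  change (infty ∈ f ⁻¹' U → ∃ p : P, ∀ q, p ≤ q → term q ∈ f ⁻¹' U) ↔ _
  refine imp_congr_right fun _ => ?_
  exact mem_atTop_sets.symm

lemma tendsto_term : Tendsto (term : P → P.withInfty) atTop (𝓝 infty) :=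
  continuous_withInfty_iff.1 (continuous_id (X := P.withInfty))

end DirectedSet

end Convergence

/-! ### The category of sketch spaces -/

namespace SketchSpace

/-- A point of a sketch space, as a morphism. -/
def pt (A : SketchSpace.{u}) (a : A.obj) : one.{u} ⟶ A :=
  ObjectProperty.homMk (fromDiscrete (X := A.obj) fun _ => a)

lemma pt_comp {A B : SketchSpace.{u}} (a : A.obj) (f : A ⟶ B) :
    pt A a ≫ f = pt B (f.hom a) := rfl

lemma pt_one (a : one.{u}.obj) : pt one a = 𝟙 one := rfl

end SketchSpace

lemma DirectedSet.toWithInfty_cancel {P : DirectedSet.{u}} {Y : TopCat.{u}}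
    {f g : P.withInfty ⟶ Y} (h : P.toWithInfty ≫ f = P.toWithInfty ≫ g) : f = g :=
  TopCat.ext fun x => ConcreteCategory.congr_hom h x

/-- The distinguished cocones are colimit cocones in the category of spaces. -/
lemma IsDistinguished.nonempty_isColimit {s : SmallCocone.{u} SketchSpace.{u}}
    (hs : IsDistinguished s) : Nonempty (IsColimit (IsSketchSpace.ι.mapCocone s.cocone)) := by
  cases hs with
  | discrete I =>
    exact ⟨{
      desc := fun t => fromDiscrete fun i => t.ι.app ⟨i⟩ PUnit.unit
      fac := fun t ⟨i⟩ => TopCat.ext fun _ => rfl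
      uniq := fun t m hm => TopCat.ext fun i => ConcreteCategory.congr_hom (hm ⟨i⟩) PUnit.unit }⟩
  | withInfty P =>
    -- A cocone consists of two morphisms which agree on the points, hence are equal.
    refine ⟨{
      desc := fun t => t.ι.app (.right ⟨true⟩)
      fac := fun t j => ?_
      uniq := fun t m hm => (Category.id_comp m).symm.trans (hm (.right ⟨true⟩)) }⟩
    have h1 := t.w (WalkingMultispan.Hom.fst PUnit.unit)
    have h2 := t.w (WalkingMultispan.Hom.snd PUnit.unit)
    obtain ⟨⟩ | ⟨_ | _⟩ := j
    · exact h2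
    · exact (Category.id_comp _).trans (P.toWithInfty_cancel (h2.trans h1.symm))
    · exact Category.id_comp _
  | locality P R h hh c hc => exact ⟨hc⟩
  | iteration P Q c hc => exact ⟨hc⟩

/-- The points of the vertex of a distinguished cocone come from the diagram. -/
lemma IsDistinguished.exists_ι_eq {s : SmallCocone.{u} SketchSpace.{u}}
    (hs : IsDistinguished s) (a : s.cocone.pt.obj) :
    ∃ (j : s.J) (b : (s.K.obj j).obj), (s.cocone.ι.app j).hom b = a := by
  obtain ⟨hc⟩ := hs.nonempty_isColimit
  exact Types.jointly_surjective_of_isColimit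
    (isColimitOfPreserves (CategoryTheory.forget TopCat.{u}) hc) a

/-- A colimit cocone in the category of spaces over a diagram of sketch spaces, lifted to the
category of sketch spaces. -/
abbrev liftCocone {J : Type u} [SmallCategory J] {F : J ⥤ TopCat.{u}}
    (hF : ∀ j, IsSketchSpace (F.obj j)) (c : Cocone F) (hc : IsSketchSpace c.pt) :
    Cocone (IsSketchSpace.lift F hF) where
  pt := ⟨c.pt, hc⟩
  ι := { app := fun j => ObjectProperty.homMk (c.ι.app j)
         naturality := fun _ _ f => InducedCategory.hom_ext (c.ι.naturality f) }

/-- Induction on sketch spaces: all sketch spaces are built from the one-point space and the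
spaces `P ∪ {∞}` by distinguished cocones. -/
lemma SketchSpace.induction {p : SketchSpace.{u} → Prop} (one : p one)
    (withInfty : ∀ P, (∀ I, p (discrete I)) → p (withInfty P))
    (distinguished : ∀ s : SmallCocone.{u} SketchSpace.{u}, IsDistinguished s →
      (∀ j, p (s.K.obj j)) → p s.cocone.pt) (A : SketchSpace.{u}) : p A := by
  have hd : ∀ I, p (discrete I) := fun I =>
    distinguished _ (IsDistinguished.discrete I) fun _ => one
  obtain ⟨X, hX⟩ := A
  cases hX with
  | discrete I => exact hd I
  | withInfty P => exact withInfty P hd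
  | locality P R h hh c hc =>
    refine distinguished _ (IsDistinguished.locality P R h hh
      (liftCocone (localityDiagram_mem P R h) c (.locality P R h hh c hc)) hc) ?_
    rintro (Q | (_ | Q))
    · exact hd _
    · exact hd _
    · exact withInfty _ hd
  | iteration P Q c hc =>
    refine distinguished _ (IsDistinguished.iteration P Q
      (liftCocone (iterationDiagram_mem P Q) c (.iteration P Q c hc)) hc) ?_
    rintro (Q | (_ | Q))
    · exact hd _
    · exact withInfty _ hd
    · exact withInfty _ hd

/-! ### Representable models -/

/-- The contravariant functor on sketch spaces that is represented by a space. -/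
abbrev nerveObj (Y : TopCat.{u}) : SketchSpace.{u}ᵒᵖ ⥤ Type u :=
  IsSketchSpace.ι.op ⋙ yoneda.obj Y

lemma isModel_nerveObj (Y : TopCat.{u}) : topSketch.IsModel (Type u) (nerveObj Y) := by
  rintro _ ⟨s, hs, rfl⟩
  obtain ⟨hc⟩ := IsDistinguished.nonempty_isColimit hs
  exact ⟨isLimitOfPreserves (yoneda.obj Y) hc.op⟩

lemma LimitSketch.IsModel.of_iso {E : Type w} [Category.{v} E] {S : LimitSketch.{u} E}
    {C : Type w'} [Category.{v'} C] {M N : E ⥤ C} (hM : S.IsModel C M) (e : M ≅ N) :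
    S.IsModel C N :=
  fun s hs => (hM s hs).map fun h => IsLimit.mapConeEquiv e h

/-- The nerve of a sketch space is representable. -/
def coyonedaIsoNerve (A : SketchSpace.{u}) : coyoneda.obj (op (op A)) ≅ nerveObj A.obj :=
  NatIso.ofComponents (fun B => Equiv.toIso
    { toFun := fun f => f.unop.hom
      invFun := fun f => (ObjectProperty.homMk f : B.unop ⟶ A).op
      left_inv := fun _ => rfl
      right_inv := fun _ => rfl })
    fun _ => rfl

/-- The representable functors are nerves, which are models. -/
lemma topSketch_realized : topSketch.{u}.Realized := fun A =>
  (isModel_nerveObj A.unop.obj).of_iso (coyonedaIsoNerve A.unop).symm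

/-- Discrete spaces of different cardinality are not isomorphic, and the cardinals do not form
a small type. -/
lemma not_essentiallySmall_sketchSpace : ¬ EssentiallySmall.{u} SketchSpace.{u}ᵒᵖ := by
  intro h
  have h := (essentiallySmall_iff _).1 h |>.1
  let f : Cardinal.{u} → Skeleton SketchSpace.{u}ᵒᵖ := fun c =>
    toSkeleton (op (SketchSpace.discrete c.out))
  have hf : Function.Injective f := fun c d hcd => by
    obtain ⟨e⟩ := toSkeleton_eq_toSkeleton_iff.1 hcd
    have e' := TopCat.homeoOfIso (IsSketchSpace.ι.mapIso e.unop)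
    rw [← Cardinal.mk_out c, ← Cardinal.mk_out d]
    exact Cardinal.mk_congr e'.toEquiv.symm
  exact not_small_cardinal.{u, u} (small_of_injective hf)

/-! ### Generalized elements of topological space objects -/

section Points

variable {C : Type w} [Category.{u} C] [HasLimits C]

/-- A net of generalized elements of `X` and a generalized element of `X`, all with domain `T`,
factor through `ι : K ⟶ X ^ P × X`. -/
def NetFactors {X K T : C} {P : Type u} (ι : K ⟶ netPow X P) (x : P → (T ⟶ X)) (s : T ⟶ X) :
    Prop :=
  ∃ c : T ⟶ K, c ≫ ι = prod.lift (Pi.lift x) s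

lemma netPow_eq_lift {X T : C} {P : Type u} (z : T ⟶ netPow X P) :
    z = prod.lift (Pi.lift fun p => z ≫ netPow.term X p) (z ≫ netPow.limit X P) :=
  TopObj.netPow_hom_ext (fun p => by rw [TopObj.lift_term]) (by rw [TopObj.lift_limit])

lemma netFactors_iff {X K T : C} {P : Type u} {ι : K ⟶ netPow X P} {x : P → (T ⟶ X)}
    {s : T ⟶ X} : NetFactors ι x s ↔ ∃ c : T ⟶ K, (∀ p, c ≫ ι ≫ netPow.term X p = x p) ∧
      c ≫ ι ≫ netPow.limit X P = s := by
  refine exists_congr fun c => ⟨fun h => ⟨fun p => ?_, ?_⟩, fun h => ?_⟩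
  · rw [reassoc_of% h, TopObj.lift_term]
  · rw [reassoc_of% h, TopObj.lift_limit]
  · refine TopObj.netPow_hom_ext (fun p => ?_) ?_
    · rw [Category.assoc, h.1, TopObj.lift_term]
    · rw [Category.assoc, h.2, TopObj.lift_limit]

lemma NetFactors.precomp {X K T T' : C} {P : Type u} {ι : K ⟶ netPow X P} {x : P → (T ⟶ X)}
    {s : T ⟶ X} (h : NetFactors ι x s) (t : T' ⟶ T) :
    NetFactors ι (fun p => t ≫ x p) (t ≫ s) := by
  obtain ⟨c, h1, h2⟩ := netFactors_iff.1 h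
  exact netFactors_iff.2 ⟨t ≫ c, fun p => by rw [Category.assoc, h1],
    by rw [Category.assoc, h2]⟩

/-- The universal net and its limit point. -/
lemma netFactors_self {X K : C} {P : Type u} (ι : K ⟶ netPow X P) :
    NetFactors ι (fun p => ι ≫ netPow.term X p) (ι ≫ netPow.limit X P) :=
  netFactors_iff.2 ⟨𝟙 K, fun _ => Category.id_comp _, Category.id_comp _⟩

namespace TopObj

variable (A : TopObj C)

/-- The generalized elements of a topological space object with a fixed domain have a convergence
class: a net converges to a point when they factor through the object of convergent nets. -/
def convergenceClass (T : C) : ConvergenceClass (T ⟶ A.X) where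
  conv P x s := NetFactors (A.ι P) x s
  const P s := by
    obtain ⟨c, hc⟩ := A.const P
    refine netFactors_iff.2 ⟨s ≫ c, fun p => ?_, ?_⟩
    · rw [Category.assoc, reassoc_of% hc, lift_term, Category.comp_id]
    · rw [Category.assoc, reassoc_of% hc, lift_limit, Category.comp_id]
  subnet P Q h hh x s hx := by
    obtain ⟨c, hc⟩ := A.subnet P Q h hh
    obtain ⟨d, h1, h2⟩ := netFactors_iff.1 hx
    refine netFactors_iff.2 ⟨d ≫ c, fun q => ?_, ?_⟩
    · rw [Category.assoc, reassoc_of% hc, reindex_term, h1, Function.comp_apply]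
    · rw [Category.assoc, reassoc_of% hc, reindex_limit, h2]
  locality P R h hh x s hx := by
    obtain ⟨c, hc⟩ := A.locality P R h hh
    choose d hd using hx
    refine ⟨pullback.lift (Pi.lift d) (prod.lift (Pi.lift x) s) ?_ ≫ c, ?_⟩
    · refine Pi.hom_ext _ _ fun Q => ?_
      rw [Category.assoc, Category.assoc, Limits.Pi.map_π, Pi.lift_π, Pi.lift_π_assoc, hd]
      refine netPow_hom_ext (fun r => ?_) ?_
      · rw [lift_term, Category.assoc, reindex_term, lift_term]
      · rw [lift_limit, Category.assoc, reindex_limit, lift_limit]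
    · rw [Category.assoc, hc, pullback.lift_snd]
  iteration P Q x y s hx hy := by
    obtain ⟨c, hc⟩ := A.iteration P Q
    choose d hd using fun p => netFactors_iff.1 (hx p)
    obtain ⟨e, he, he'⟩ := netFactors_iff.1 hy
    refine netFactors_iff.2 ⟨pullback.lift (Pi.lift d) e ?_ ≫ c, fun a => ?_, ?_⟩
    · refine Pi.hom_ext _ _ fun p => ?_
      rw [Category.assoc, Limits.Pi.map_π, Pi.lift_π_assoc, (hd p).2]
      simpa using (he p).symm
    · rw [Category.assoc, reassoc_of% hc, lift_term, pullback.lift_fst_assoc, Pi.lift_π_assoc,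
        (hd a.1).1]
    · rw [Category.assoc, reassoc_of% hc, lift_limit, pullback.lift_snd_assoc, he']

/-- A topological space object is given by an object `X` and monomorphisms to the objects
`X ^ P × X`, if for all `T` the nets of generalized elements with domain `T` which factor through
them belong to a convergence class. -/
noncomputable def ofConvergenceClass {X : C} {conv : DirectedSet.{u} → C}
    (ι : ∀ P, conv P ⟶ netPow X P) (mono_ι : ∀ P, Mono (ι P))
    (K : ∀ T : C, ConvergenceClass (T ⟶ X))
    (hK : ∀ (T : C) (P : DirectedSet.{u}) (x : P → (T ⟶ X)) (s : T ⟶ X),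
      (K T).conv P x s ↔ NetFactors (ι P) x s) : TopObj C where
  X := X
  conv := conv
  ι := ι
  mono_ι := mono_ι
  const P := (hK _ _ _ _).1 ((K X).const P (𝟙 X))
  subnet P Q h hh := by
    obtain ⟨c, hc⟩ := (hK _ _ _ _).1 ((K _).subnet P Q h hh _ _ ((hK _ _ _ _).2
      (netFactors_self (ι P))))
    refine ⟨c, hc.trans ?_⟩
    refine netPow_hom_ext (fun q => ?_) ?_
    · rw [lift_term, Category.assoc, reindex_term, Function.comp_apply]
    · rw [lift_limit, Category.assoc, reindex_limit]
  locality P R h hh := by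
    rw [netPow_eq_lift (pullback.snd _ _)]
    refine (hK _ _ _ _).1 ((K _).locality P R h hh _ _ fun Q => (hK _ _ _ _).2 ?_)
    refine ⟨pullback.fst _ _ ≫ Pi.π _ Q, ?_⟩
    have e := pullback.condition (f := Limits.Pi.map fun Q => ι (R Q))
      (g := Pi.lift fun Q => netPow.reindex X fun r : R Q => (h Q r : P)) =≫ Pi.π _ Q
    rw [Category.assoc, Category.assoc, Limits.Pi.map_π, Pi.lift_π] at e
    rw [Category.assoc, e]
    refine netPow_hom_ext (fun r => ?_) ?_
    · rw [lift_term, Category.assoc, reindex_term]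
    · rw [lift_limit, Category.assoc, reindex_limit]
  iteration P Q := by
    have e := pullback.condition (f := Limits.Pi.map fun p => ι (Q p) ≫ netPow.limit X (Q p))
      (g := ι P ≫ prod.fst)
    have h1 : ∀ p, (K _).conv (Q p)
        (fun q => (pullback.fst (Limits.Pi.map fun p => ι (Q p) ≫ netPow.limit X (Q p))
          (ι P ≫ prod.fst) ≫ Pi.π (fun p => conv (Q p)) p) ≫ ι (Q p) ≫ netPow.term X q)
        (pullback.snd _ _ ≫ ι P ≫ netPow.term X p) := fun p => by
      have e' := e =≫ Pi.π _ p
      rw [Category.assoc, Category.assoc, Category.assoc, Limits.Pi.map_π,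
        ← Category.assoc _ (Pi.π _ p)] at e'
      rw [← e']
      exact (hK _ _ _ _).2 ((netFactors_self (ι (Q p))).precomp _)
    have h2 := (hK _ _ _ _).2 ((netFactors_self (ι P)).precomp (pullback.snd
      (Limits.Pi.map fun p => ι (Q p) ≫ netPow.limit X (Q p)) (ι P ≫ prod.fst)))
    simpa only [NetFactors, Category.assoc] using
      (hK _ _ _ _).1 ((K _).iteration P Q _ _ _ h1 h2)

variable {A} in
/-- Morphisms of topological space objects preserve convergent nets of generalized elements. -/
lemma preserves_iff {B : TopObj C} {f : A.X ⟶ B.X} :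
    (∀ P : DirectedSet.{u}, ∃ c : A.conv P ⟶ B.conv P, c ≫ B.ι P = A.ι P ≫ netPow.map f P) ↔
      ∀ (T : C) (P : DirectedSet.{u}) (x : P → (T ⟶ A.X)) (s : T ⟶ A.X),
        (A.convergenceClass T).conv P x s →
          (B.convergenceClass T).conv P (fun p => x p ≫ f) (s ≫ f) := by
  refine ⟨fun h T P x s ⟨d, hd⟩ => ?_, fun h P => ?_⟩
  · obtain ⟨c, hc⟩ := h P
    refine ⟨d ≫ c, ?_⟩
    rw [Category.assoc, hc, reassoc_of% hd]
    refine netPow_hom_ext (fun p => ?_) ?_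
    · rw [lift_term, Category.assoc, map_term, ← Category.assoc, lift_term]
    · rw [lift_limit, Category.assoc, map_limit, ← Category.assoc, lift_limit]
  · obtain ⟨c, hc⟩ := h _ P _ _ (netFactors_self (A.ι P))
    refine ⟨c, hc.trans (netPow_hom_ext (fun p => ?_) ?_)⟩
    · rw [lift_term, Category.assoc (A.ι P) (netPow.map f P), map_term, Category.assoc]
    · rw [lift_limit, Category.assoc (A.ι P) (netPow.map f P), map_limit, Category.assoc]

/-- An isomorphism of the underlying objects that preserves and reflects convergent nets of
generalized elements is an isomorphism of topological space objects. -/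
def mkIso {A B : TopObj C} (e : A.X ≅ B.X)
    (h : ∀ (T : C) (P : DirectedSet.{u}) (x : P → (T ⟶ A.X)) (s : T ⟶ A.X),
      (A.convergenceClass T).conv P x s ↔
        (B.convergenceClass T).conv P (fun p => x p ≫ e.hom) (s ≫ e.hom)) : A ≅ B where
  hom := ⟨e.hom, preserves_iff.2 fun T P x s => (h T P x s).1⟩
  inv := ⟨e.inv, preserves_iff.2 fun T P x s hx => (h T P _ _).2 (by simpa using hx)⟩
  hom_inv_id := Hom.ext e.hom_inv_id
  inv_hom_id := Hom.ext e.inv_hom_id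

end TopObj

end Points

/-! ### Families of generalized elements of models -/

section Families

variable {C : Type w} [Category.{v'} C]

open SketchSpace

/-- A family of generalized elements `T ⟶ M(1)`, indexed by the points of a sketch space `A`,
is continuous if it is induced by a morphism `T ⟶ M(A)`. -/
def IsContinuousFamily (M : SketchSpace.{u}ᵒᵖ ⥤ C) (A : SketchSpace.{u}) {T : C}
    (x : A.obj → (T ⟶ M.obj (op one))) : Prop :=
  ∃ c : T ⟶ M.obj (op A), ∀ a, c ≫ M.map (pt A a).op = x a

variable {M : SketchSpace.{u}ᵒᵖ ⥤ C} {T : C}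

lemma map_map_pt {A B : SketchSpace.{u}} (f : A ⟶ B) (a : A.obj) :
    M.map f.op ≫ M.map (pt A a).op = M.map (pt B (f.hom a)).op := by
  rw [← M.map_comp, ← op_comp, pt_comp]

lemma isContinuousFamily_self (M : SketchSpace.{u}ᵒᵖ ⥤ C) (A : SketchSpace.{u}) :
    IsContinuousFamily M A fun a => M.map (pt A a).op :=
  ⟨𝟙 _, fun _ => Category.id_comp _⟩

lemma IsContinuousFamily.precomp {A : SketchSpace.{u}} {x : A.obj → (T ⟶ M.obj (op one))}
    (hx : IsContinuousFamily M A x) {T' : C} (t : T' ⟶ T) :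
    IsContinuousFamily M A fun a => t ≫ x a := by
  obtain ⟨c, hc⟩ := hx
  exact ⟨t ≫ c, fun a => by rw [Category.assoc, hc]⟩

lemma IsContinuousFamily.comp {A B : SketchSpace.{u}} {x : B.obj → (T ⟶ M.obj (op one))}
    (hx : IsContinuousFamily M B x) (f : A ⟶ B) :
    IsContinuousFamily M A fun a => x (f.hom a) := by
  obtain ⟨c, hc⟩ := hx
  exact ⟨c ≫ M.map f.op, fun a => by rw [Category.assoc, map_map_pt, hc]⟩

lemma isContinuousFamily_one (x : one.{u}.obj → (T ⟶ M.obj (op one))) :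
    IsContinuousFamily M one x :=
  ⟨x PUnit.unit, fun a => by rw [pt_one, op_id, M.map_id, Category.comp_id]; rfl⟩

namespace LimitSketch.IsModel

variable {s : SmallCocone.{u} SketchSpace.{u}}

/-- The limit property of the image of a distinguished cocone. -/
lemma exists_lift (hM : topSketch.IsModel C M) (hs : IsDistinguished s)
    (c : ∀ j, T ⟶ M.obj (op (s.K.obj j)))
    (hc : ∀ ⦃i j⦄ (f : i ⟶ j), c j ≫ M.map (s.K.map f).op = c i) :
    ∃ d : T ⟶ M.obj (op s.cocone.pt), ∀ j, d ≫ M.map (s.cocone.ι.app j).op = c j := by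
  obtain ⟨hl⟩ := hM _ ⟨s, hs, rfl⟩
  let t : Cone (s.K.op ⋙ M) :=
    { pt := T
      π := { app := fun j => c j.unop
             naturality := fun i j f => (Category.id_comp _).trans (hc f.unop).symm } }
  exact ⟨hl.lift t, fun j => hl.fac t (op j)⟩

lemma distinguished_hom_ext (hM : topSketch.IsModel C M) (hs : IsDistinguished s)
    {c d : T ⟶ M.obj (op s.cocone.pt)}
    (h : ∀ j, c ≫ M.map (s.cocone.ι.app j).op = d ≫ M.map (s.cocone.ι.app j).op) : c = d := by
  obtain ⟨hl⟩ := hM _ ⟨s, hs, rfl⟩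
  exact hl.hom_ext fun j => h j.unop

/-- A model maps `P ⊔ 1 ⟶ P ∪ {∞}` to a monomorphism, because it preserves the epimorphism
cocone. -/
lemma toWithInfty_hom_ext (hM : topSketch.IsModel C M) {P : DirectedSet.{u}}
    {c d : T ⟶ M.obj (op (withInfty P))}
    (h : c ≫ M.map (toWithInfty P).op = d ≫ M.map (toWithInfty P).op) : c = d := by
  -- `c` and `d` form a cone over the epimorphism square, and its two outer legs are identities.
  obtain ⟨l, hl⟩ := hM.exists_lift (IsDistinguished.withInfty P) (T := T)
    (fun j => match j with
      | .left _ => c ≫ M.map (toWithInfty P).op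
      | .right ⟨false⟩ => c
      | .right ⟨true⟩ => d) (by
    rintro i j (_ | _ | _)
    · exact (congrArg _ ((congrArg _ (congrArg _ (CategoryTheory.Functor.map_id _ _))).trans
        (M.map_id _))).trans (Category.comp_id _)
    · rfl
    · exact h.symm)
  exact (hl (.right ⟨false⟩)).symm.trans (hl (.right ⟨true⟩))

/-- The values of a model embed into powers of its value at the one-point space. -/
lemma hom_ext (hM : topSketch.IsModel C M) (A : SketchSpace.{u}) : ∀ {T : C}
    {c d : T ⟶ M.obj (op A)}, (∀ a, c ≫ M.map (pt A a).op = d ≫ M.map (pt A a).op) → c = d := by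
  induction A using SketchSpace.induction with
  | one =>
    intro T c d h
    have h' := h PUnit.unit
    rwa [show pt one PUnit.unit = 𝟙 one from rfl, op_id, M.map_id, Category.comp_id,
      Category.comp_id] at h'
  | withInfty P ih =>
    intro T c d h
    refine hM.toWithInfty_hom_ext (ih _ fun a => ?_)
    rw [Category.assoc, Category.assoc, map_map_pt, h]
  | distinguished s hs ih =>
    intro T c d h
    refine hM.distinguished_hom_ext hs fun j => ih j fun a => ?_
    rw [Category.assoc, Category.assoc, map_map_pt]
    exact h _

/-- Compatible continuous families can be glued along a distinguished cocone. -/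
lemma exists_isContinuousFamily (hM : topSketch.IsModel C M) (hs : IsDistinguished s)
    (x : ∀ j, (s.K.obj j).obj → (T ⟶ M.obj (op one)))
    (hx : ∀ j, IsContinuousFamily M (s.K.obj j) (x j))
    (hc : ∀ ⦃i j⦄ (f : i ⟶ j) (a), x j ((s.K.map f).hom a) = x i a) :
    ∃ y, IsContinuousFamily M s.cocone.pt y ∧ ∀ j a, y ((s.cocone.ι.app j).hom a) = x j a := by
  choose c hc' using hx
  obtain ⟨d, hd⟩ := hM.exists_lift hs c fun i j f => hM.hom_ext _ fun a => by
    rw [Category.assoc, map_map_pt, hc', hc', hc]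
  refine ⟨fun a => d ≫ M.map (pt _ a).op, (isContinuousFamily_self M _).precomp d, fun j a => ?_⟩
  rw [← hc', ← hd, Category.assoc, map_map_pt]
  rfl

/-- Continuity of a family can be tested on the diagram of a distinguished cocone. -/
lemma isContinuousFamily_distinguished (hM : topSketch.IsModel C M) (hs : IsDistinguished s)
    {x : s.cocone.pt.obj → (T ⟶ M.obj (op one))}
    (hx : ∀ j, IsContinuousFamily M (s.K.obj j) fun a => x ((s.cocone.ι.app j).hom a)) :
    IsContinuousFamily M s.cocone.pt x := by
  obtain ⟨y, hy, hxy⟩ := hM.exists_isContinuousFamily hs _ hx fun i j f a => by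
    rw [← s.cocone.w f]; rfl
  obtain rfl : y = x := funext fun a => by
    obtain ⟨j, b, rfl⟩ := hs.exists_ι_eq a
    exact hxy j b
  exact hy

lemma isContinuousFamily_discrete (hM : topSketch.IsModel C M) (I : Type u)
    (x : (SketchSpace.discrete I).obj → (T ⟶ M.obj (op one))) :
    IsContinuousFamily M (SketchSpace.discrete I) x :=
  hM.isContinuousFamily_distinguished (IsDistinguished.discrete I) fun _ =>
    isContinuousFamily_one _

end LimitSketch.IsModel

end Families

/-! ### The topological space object of a model -/

section ToTopObj

open Filter Topology SketchSpace DirectedSet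

variable {C : Type w} [Category.{u} C] {M : SketchSpace.{u}ᵒᵖ ⥤ C} {T : C}

/-- The morphism on `P ∪ {∞}` that is given by a convergent net. -/
def SketchSpace.ofNet {P : DirectedSet.{u}} {A : SketchSpace.{u}} {y : P → A.obj} {t : A.obj}
    (h : Tendsto y atTop (𝓝 t)) : withInfty P ⟶ A :=
  ObjectProperty.homMk (TopCat.ofHom (X := P.withInfty) ⟨extend y t, continuous_withInfty_iff.2 h⟩)

/-- A continuous family on a sketch space restricts to a continuous family on every convergent net
in it. -/
lemma IsContinuousFamily.extend {A : SketchSpace.{u}} {x : A.obj → (T ⟶ M.obj (op one))}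
    (hx : IsContinuousFamily M A x) {P : DirectedSet.{u}} {y : P → A.obj} {t : A.obj}
    (h : Tendsto y atTop (𝓝 t)) :
    IsContinuousFamily M (withInfty P) (extend (fun p => x (y p)) (x t)) := by
  have e : DirectedSet.extend (fun p => x (y p)) (x t) = fun a => x ((ofNet h).hom a) :=
    extend_eta fun a => x ((ofNet h).hom a)
  exact e ▸ hx.comp (ofNet h)

/-- The generalized elements with a fixed domain of the value at the one-point space of a model have
a convergence class: a net converges to a point if they form a continuous family on `P ∪ {∞}`.
The axioms on locality and iterations follow from the corresponding colimits in the sketch, in which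
certain nets of points converge because the axioms hold in all topological spaces. -/
def LimitSketch.IsModel.convergenceClass (hM : topSketch.IsModel C M) (T : C) :
    ConvergenceClass (T ⟶ M.obj (op one)) where
  conv P x s := IsContinuousFamily M (withInfty P) (extend x s)
  const P s :=
    ((isContinuousFamily_one fun _ => s).extend (P := P)
      (tendsto_const_nhds (x := (PUnit.unit : one.{u}.obj))) : IsContinuousFamily M _ _)
  subnet P Q h hh x s hx := hx.extend (y := fun q => term (h q)) (t := infty)
    (tendsto_term.comp hh.tendsto)
  locality P R h hh x s hx := by
    let c := colimit.cocone (localityDiagram P R h)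
    let hc : IsColimit c := colimit.isColimit _
    let c' := liftCocone (localityDiagram_mem P R h) c (.locality P R h hh c hc)
    obtain ⟨y, hy, hxy⟩ := hM.exists_isContinuousFamily (T := T)
      (IsDistinguished.locality P R h hh c' hc) (fun j => match j with
        | .left Q => fun a : Option (R Q) => a.elim s fun r => x (h Q r)
        | .right none => fun a : Option P => a.elim s x
        | .right (some Q) => extend (fun r => x (h Q r)) s)
      (by
        rintro (Q | (_ | Q))
        exacts [hM.isContinuousFamily_discrete _ _, hM.isContinuousFamily_discrete _ _, hx Q])
      (by
        rintro i j (_ | Q | Q)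
        · exact fun _ => rfl
        · exact fun a : Option (R Q) => by cases a <;> rfl
        · exact fun a : Option (R Q) => by cases a <;> rfl)
    have hw (Q : CofinalSubset P) (a : Option (R Q)) : c.ι.app (.right (some Q)) a =
        c.ι.app (.right none) (a.map fun r => (h Q r : P)) :=
      ConcreteCategory.congr_hom ((c.w (WalkingMultispan.Hom.fst Q)).trans
        (c.w (WalkingMultispan.Hom.snd Q)).symm) a
    -- The indices in `P` converge to `∞` in the colimit, by locality in this space.
    have ht : Tendsto (fun p : P => c.ι.app (.right none) (some p)) atTop
        (𝓝 (c.ι.app (.right none) (none : Option P))) := by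
      refine (ConvergenceClass.ofTopologicalSpace c.pt).locality P R h hh _ _ fun Q => ?_
      have := ((c.ι.app (.right (some Q))).hom.continuous.tendsto infty).comp tendsto_term
      exact (hw Q none) ▸ this.congr fun r => hw Q (some r)
    have e : DirectedSet.extend x s = _ :=
      congrArg₂ extend (funext fun p => (hxy (.right none) (some p)).symm)
        (hxy (.right none) (none : Option P)).symm
    exact e ▸ hy.extend ht
  iteration P Q x y s hx hy := by
    let c := colimit.cocone (iterationDiagram P Q)
    let hc : IsColimit c := colimit.isColimit _
    let c' := liftCocone (iterationDiagram_mem P Q) c (.iteration P Q c hc)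
    obtain ⟨z, hz, hxz⟩ := hM.exists_isContinuousFamily (T := T)
      (IsDistinguished.iteration P Q c' hc) (fun j => match j with
        | .left p => fun _ => y p
        | .right none => extend y s
        | .right (some p) => extend (x p) (y p))
      (by
        rintro (p | (_ | p))
        exacts [hM.isContinuousFamily_discrete _ _, hy, hx p])
      (by
        rintro i j (_ | Q | Q) <;> exact fun _ => rfl)
    have hw (p : P) : c.ι.app (.right (some p)) (infty : (Q p).withInfty) =
        c.ι.app (.right none) (term p : P.withInfty) :=
      ConcreteCategory.congr_hom ((c.w (WalkingMultispan.Hom.fst p)).trans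
        (c.w (WalkingMultispan.Hom.snd p)).symm) PUnit.unit
    -- The iterated net of the indices converges to `∞` in the colimit.
    have ht := (ConvergenceClass.ofTopologicalSpace c.pt).iteration P Q
      (fun p q => c.ι.app (.right (some p)) (term q : (Q p).withInfty))
      (fun p => c.ι.app (.right none) (term p : P.withInfty))
      (c.ι.app (.right none) (infty : P.withInfty))
      (fun p => hw p ▸
        ((c.ι.app (.right (some p))).hom.continuous.tendsto infty).comp tendsto_term)
      (((c.ι.app (.right none)).hom.continuous.tendsto infty).comp tendsto_term)
    have e : DirectedSet.extend (fun a : P.iter Q => x a.1 (a.2 a.1)) s = _ :=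
      congrArg₂ extend (funext fun a => (hxz (.right (some a.1)) (term (a.2 a.1))).symm)
        (hxz (.right none) (infty : P.withInfty)).symm
    exact e ▸ hz.extend ht

/-- If composition with a morphism `f` preserves continuous families on the spaces `P ∪ {∞}`, then
it preserves continuous families on all sketch spaces. -/
lemma IsContinuousFamily.postcomp {M N : SketchSpace.{u}ᵒᵖ ⥤ C} (hN : topSketch.IsModel C N)
    {f : M.obj (op one) ⟶ N.obj (op one)}
    (hf : ∀ {T : C} {P : DirectedSet.{u}} {x : P → (T ⟶ M.obj (op one))} {s : T ⟶ M.obj (op one)},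
      IsContinuousFamily M (withInfty P) (DirectedSet.extend x s) →
      IsContinuousFamily N (withInfty P) (DirectedSet.extend (fun p => x p ≫ f) (s ≫ f)))
    (A : SketchSpace.{u}) : ∀ {T : C} {x : A.obj → (T ⟶ M.obj (op one))},
      IsContinuousFamily M A x → IsContinuousFamily N A (fun a => x a ≫ f) := by
  induction A using SketchSpace.induction with
  | one => exact fun _ => isContinuousFamily_one _
  | withInfty P ih =>
    intro T x hx
    exact (extend_eta fun a => x a ≫ f) ▸ hf ((extend_eta x).symm ▸ hx)
  | distinguished s hs ih =>
    exact fun hx => hN.isContinuousFamily_distinguished hs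
      fun j => ih j (hx.comp (s.cocone.ι.app j))

/-- A morphism between the values at the one-point space extends to a natural transformation of
models if it preserves continuous families on the spaces `P ∪ {∞}`. -/
lemma LimitSketch.IsModel.exists_natTrans {M N : SketchSpace.{u}ᵒᵖ ⥤ C}
    (hN : topSketch.IsModel C N) {f : M.obj (op one) ⟶ N.obj (op one)}
    (hf : ∀ {T : C} {P : DirectedSet.{u}} {x : P → (T ⟶ M.obj (op one))} {s : T ⟶ M.obj (op one)},
      IsContinuousFamily M (withInfty P) (DirectedSet.extend x s) →
      IsContinuousFamily N (withInfty P) (DirectedSet.extend (fun p => x p ≫ f) (s ≫ f))) :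
    ∃ φ : M ⟶ N, φ.app (op one) = f := by
  choose φ hφ using fun A : SketchSpace.{u} => (isContinuousFamily_self M A).postcomp hN hf
  refine ⟨{ app := fun A => φ A.unop
            naturality := fun A B g => hN.hom_ext B.unop fun a => ?_ }, ?_⟩
  · rw [Category.assoc, Category.assoc, hφ, ← g.op_unop, map_map_pt, hφ, ← Category.assoc,
      map_map_pt]
  · have h : φ one ≫ N.map (𝟙 _) = M.map (𝟙 _) ≫ f := hφ one PUnit.unit
    rwa [N.map_id, M.map_id, Category.comp_id, Category.id_comp] at h

end ToTopObj

/-! ### The functor from models to topological space objects -/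

section Equivalence

open Filter Topology SketchSpace DirectedSet

variable {C : Type w} [Category.{u} C] [HasLimits C]

namespace LimitSketch.IsModel

variable {M : SketchSpace.{u}ᵒᵖ ⥤ C}

variable (M) in
/-- The morphism from the value of a model at `P ∪ {∞}` to the object of nets. -/
noncomputable def netInclusion (P : DirectedSet.{u}) :
    M.obj (op (withInfty P)) ⟶ netPow (M.obj (op one)) P :=
  prod.lift (Pi.lift fun p => M.map (pt (withInfty P) (term p)).op)
    (M.map (pt (withInfty P) infty).op)

lemma netFactors_netInclusion_iff {T : C} {P : DirectedSet.{u}} {x : P → (T ⟶ M.obj (op one))}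
    {s : T ⟶ M.obj (op one)} : NetFactors (netInclusion M P) x s ↔
      IsContinuousFamily M (withInfty P) (extend x s) := by
  rw [netFactors_iff]
  refine exists_congr fun c => ?_
  rw [netInclusion, TopObj.lift_limit]
  simp_rw [TopObj.lift_term]
  refine ⟨fun h a => ?_, fun h => ⟨fun p => h (term p), h infty⟩⟩
  cases a using withInfty_cases with
  | term p => exact h.1 p
  | infty => exact h.2

lemma mono_netInclusion (hM : topSketch.IsModel C M) (P : DirectedSet.{u}) :
    Mono (netInclusion M P) where
  right_cancellation c d h := hM.hom_ext _ fun a => by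
    cases a using withInfty_cases with
    | term p =>
      have := h =≫ netPow.term _ p
      rwa [Category.assoc, Category.assoc, netInclusion, TopObj.lift_term] at this
    | infty =>
      have := h =≫ netPow.limit _ _
      rwa [Category.assoc, Category.assoc, netInclusion, TopObj.lift_limit] at this

/-- The topological space object of a model `M`: the underlying object is `M(1)`, and the object of
convergent nets indexed by `P` is `M(P ∪ {∞})`. -/
noncomputable def toTopObj (hM : topSketch.IsModel C M) : TopObj C :=
  TopObj.ofConvergenceClass (netInclusion M) hM.mono_netInclusion hM.convergenceClass
    fun _ _ _ _ => netFactors_netInclusion_iff.symm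

lemma toTopObj_conv_iff (hM : topSketch.IsModel C M) {T : C} {P : DirectedSet.{u}}
    {x : P → (T ⟶ M.obj (op one))} {s : T ⟶ M.obj (op one)} :
    (hM.toTopObj.convergenceClass T).conv P x s ↔
      IsContinuousFamily M (withInfty P) (extend x s) :=
  netFactors_netInclusion_iff

end LimitSketch.IsModel

variable (C) in
/-- The functor that maps a model to its topological space object. -/
noncomputable def modToTopObj : topSketch.{u}.Mod C ⥤ TopObj C where
  obj M := M.property.toTopObj
  map {M N} φ := ⟨φ.hom.app (op one), TopObj.preserves_iff.2 fun T P x s h => by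
    refine N.property.toTopObj_conv_iff.2 ?_
    obtain ⟨c, hc⟩ := M.property.toTopObj_conv_iff.1 h
    refine ⟨c ≫ φ.hom.app _, fun a => ?_⟩
    rw [Category.assoc, ← φ.hom.naturality, reassoc_of% hc]
    cases a using withInfty_cases <;> rfl⟩
  map_id _ := rfl
  map_comp _ _ := rfl

instance : (modToTopObj.{u} C).Faithful where
  map_injective {M N} φ ψ h := by
    have h : φ.hom.app (op one) = ψ.hom.app (op one) := congrArg TopObj.Hom.f h
    refine InducedCategory.hom_ext (NatTrans.ext (funext fun A => N.property.hom_ext A.unop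
      fun a => ?_))
    exact (φ.hom.naturality _).symm.trans (h ▸ ψ.hom.naturality _)

instance : (modToTopObj.{u} C).Full where
  map_surjective {M N} F := by
    obtain ⟨φ, hφ⟩ := N.property.exists_natTrans (M := M.obj) (f := F.f) fun hx =>
      N.property.toTopObj_conv_iff.1 (TopObj.preserves_iff.1 F.preserves _ _ _ _
        (M.property.toTopObj_conv_iff.2 hx))
    exact ⟨InducedCategory.homMk φ, TopObj.Hom.ext hφ⟩

/-! ### The model of a topological space object -/

namespace TopObj

variable (A : TopObj C)

/-- The presheaf of topological spaces that is given by the generalized elements of a topological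
space object. -/
def elements : Cᵒᵖ ⥤ TopCat.{u} where
  obj T := @TopCat.of (T.unop ⟶ A.X) (A.convergenceClass T.unop).topology
  map {T T'} t := @TopCat.ofHom _ _ (A.convergenceClass T.unop).topology
    (A.convergenceClass T'.unop).topology
    (@ContinuousMap.mk _ _ (A.convergenceClass T.unop).topology
      (A.convergenceClass T'.unop).topology (fun x => t.unop ≫ x) (by
        let _ := (A.convergenceClass T.unop).topology
        let _ := (A.convergenceClass T'.unop).topology
        exact ⟨fun U hU P x s hx hs => hU P _ _ (NetFactors.precomp hx t.unop) hs⟩))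
  map_id T := TopCat.ext fun x => Category.id_comp x
  map_comp f g := TopCat.ext fun x => Category.assoc g.unop f.unop x

/-- The functor that maps a sketch space `X` to the presheaf of continuous maps from `X` to
the spaces of generalized elements. -/
abbrev elementsNerve : SketchSpace.{u}ᵒᵖ ⥤ Cᵒᵖ ⥤ Type u :=
  IsSketchSpace.ι.op ⋙ coyoneda ⋙ (Functor.whiskeringLeft Cᵒᵖ TopCat (Type u)).obj A.elements

lemma isModel_elementsNerve : topSketch.IsModel _ A.elementsNerve := fun s hs =>
  ⟨evaluationJointlyReflectsLimits _ fun T => (isModel_nerveObj (A.elements.obj T) s hs).some⟩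

/-- The value of `elementsNerve` at the one-point space is represented by the underlying object. -/
def yonedaIsoElementsNerve : yoneda.obj A.X ≅ A.elementsNerve.obj (op one) :=
  NatIso.ofComponents (fun T => Equiv.toIso
    { toFun := fun x => fromDiscrete (X := A.elements.obj T) fun _ => x
      invFun := fun f => TopCat.Hom.hom (X := one.obj) (Y := A.elements.obj T) f PUnit.unit
      left_inv := fun _ => rfl
      right_inv := fun _ => rfl }) fun _ => rfl

lemma tendsto_elements_iff {T : Cᵒᵖ} {P : DirectedSet.{u}} {x : P → A.elements.obj T}
    {s : A.elements.obj T} :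
    Tendsto x atTop (𝓝 s) ↔ (A.convergenceClass T.unop).conv P x s :=
  (A.convergenceClass T.unop).conv_iff_tendsto.symm

lemma elementsNerve_withInfty_mem (P : DirectedSet.{u}) :
    yoneda.essImage (A.elementsNerve.obj (op (withInfty P))) := by
  let f (T : Cᵒᵖ) (c : T.unop ⟶ A.conv P) : P.withInfty ⟶ A.elements.obj T :=
    TopCat.ofHom (X := P.withInfty) (Y := A.elements.obj T)
      ⟨extend (fun p => c ≫ A.ι P ≫ netPow.term A.X p) (c ≫ A.ι P ≫ netPow.limit A.X P),
      continuous_withInfty_iff.2 (A.tendsto_elements_iff.2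
        ((netFactors_self (A.ι P)).precomp c))⟩
  have hf (T : Cᵒᵖ) : Function.Bijective (f T) := by
    refine ⟨fun c d h => ?_, fun g => ?_⟩
    · rw [← cancel_mono (A.ι P)]
      refine netPow_hom_ext (fun p => ?_) ?_
      · rw [Category.assoc, Category.assoc]
        exact ConcreteCategory.congr_hom h (term p)
      · rw [Category.assoc, Category.assoc]
        exact ConcreteCategory.congr_hom h infty
    · obtain ⟨c, h1, h2⟩ := netFactors_iff.1 (A.tendsto_elements_iff.1
        (continuous_withInfty_iff.1 g.hom.continuous))
      refine ⟨c, TopCat.ext fun a => ?_⟩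
      cases a using withInfty_cases with
      | term p => exact h1 p
      | infty => exact h2
  refine ⟨A.conv P, ⟨NatIso.ofComponents (fun T => (Equiv.ofBijective (f T) (hf T)).toIso)
    fun t => ?_⟩⟩
  ext c
  refine TopCat.ext fun a => ?_
  cases a using withInfty_cases <;> exact Category.assoc _ _ _

/-- All sketch spaces have a representing object, because the spaces `P ∪ {∞}` are represented
by the objects of convergent nets, and representable presheaves are closed under limits. -/
lemma elementsNerve_mem (B : SketchSpace.{u}) :
    yoneda.essImage (A.elementsNerve.obj (op B)) := by
  induction B using SketchSpace.induction with
  | one => exact ⟨_, ⟨A.yonedaIsoElementsNerve⟩⟩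
  | withInfty P => exact A.elementsNerve_withInfty_mem P
  | distinguished s hs ih =>
    obtain ⟨hl⟩ := A.isModel_elementsNerve _ ⟨s, hs, rfl⟩
    exact yoneda.essImage.prop_of_isLimit hl fun j => ih j.unop

/-- The functor that maps a sketch space to the object which represents the continuous families of
generalized elements. -/
noncomputable def toFunctor : SketchSpace.{u}ᵒᵖ ⥤ C :=
  Functor.essImage.liftFunctor A.elementsNerve yoneda fun B => A.elementsNerve_mem B.unop

/-- The defining property of `toFunctor`. -/
noncomputable def toFunctorIso : A.toFunctor ⋙ yoneda ≅ A.elementsNerve :=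
  Functor.essImage.liftFunctorCompIso _ _ _

lemma isModel_toFunctor : topSketch.IsModel C A.toFunctor := fun s hs =>
  (A.isModel_elementsNerve.of_iso A.toFunctorIso.symm s hs).map
    fun h => isLimitOfReflects yoneda h

/-- The value of `toFunctor` at the one-point space is the underlying object. -/
noncomputable def toFunctorOneIso : A.toFunctor.obj (op one) ≅ A.X :=
  yoneda.preimageIso (A.toFunctorIso.app (op one) ≪≫ A.yonedaIsoElementsNerve.symm)

/-- The continuous map that corresponds to a generalized element of a value of `toFunctor`. -/
noncomputable def toFunctorEquiv (B : SketchSpace.{u}) (T : C) :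
    (T ⟶ A.toFunctor.obj (op B)) ≃ (B.obj ⟶ A.elements.obj (op T)) :=
  ((A.toFunctorIso.app (op B)).app (op T)).toEquiv

lemma toFunctorEquiv_apply {B : SketchSpace.{u}} {T : C} (c : T ⟶ A.toFunctor.obj (op B))
    (b : B.obj) : A.toFunctorEquiv B T c b =
      (c ≫ A.toFunctor.map (pt B b).op) ≫ A.toFunctorOneIso.hom := by
  have h1 : A.toFunctorEquiv one T (c ≫ A.toFunctor.map (pt B b).op) =
      (pt B b).hom ≫ A.toFunctorEquiv B T c :=
    ConcreteCategory.congr_hom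
      (NatTrans.congr_app (A.toFunctorIso.hom.naturality (pt B b).op) (op T)) c
  have h2 (x : T ⟶ A.toFunctor.obj (op one)) :
      x ≫ A.toFunctorOneIso.hom = A.toFunctorEquiv one T x PUnit.unit :=
    ConcreteCategory.congr_hom (NatTrans.congr_app (yoneda.map_preimage
      (A.toFunctorIso.app (op one) ≪≫ A.yonedaIsoElementsNerve.symm).hom) (op T)) x
  rw [h2, h1]
  rfl

/-- The continuous families of the model `toFunctor` are the continuous maps to the spaces of
generalized elements. -/
lemma isContinuousFamily_toFunctor_iff {B : SketchSpace.{u}} {T : C}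
    {x : B.obj → (T ⟶ A.toFunctor.obj (op one))} : IsContinuousFamily A.toFunctor B x ↔
      Continuous (Y := A.elements.obj (op T)) fun b => x b ≫ A.toFunctorOneIso.hom := by
  refine ⟨fun ⟨c, hc⟩ => ?_, fun h => ?_⟩
  · obtain rfl := funext hc
    exact (funext (A.toFunctorEquiv_apply c)) ▸ (A.toFunctorEquiv B T c).hom.continuous
  · let g : B.obj ⟶ A.elements.obj (op T) := TopCat.ofHom (Y := A.elements.obj (op T)) ⟨_, h⟩
    refine ⟨(A.toFunctorEquiv B T).symm g, fun b => ?_⟩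
    rw [← cancel_mono A.toFunctorOneIso.hom, ← toFunctorEquiv_apply, Equiv.apply_symm_apply]
    rfl

/-- The topological space object of the model `toFunctor` is the original one. In both, a net of
generalized elements converges if and only if it converges in the topology of `elements`. -/
lemma nonempty_iso : Nonempty ((modToTopObj C).obj ⟨A.toFunctor, A.isModel_toFunctor⟩ ≅ A) :=
  ⟨mkIso A.toFunctorOneIso fun _ _ _ _ => A.isModel_toFunctor.toTopObj_conv_iff.trans
    (A.isContinuousFamily_toFunctor_iff.trans
      (continuous_withInfty_iff.trans A.tendsto_elements_iff))⟩

end TopObj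

instance : (modToTopObj.{u} C).EssSurj where
  mem_essImage A := ⟨_, A.nonempty_iso⟩

instance : (modToTopObj.{u} C).IsEquivalence where

end Equivalence

/-! ### Naturality -/

section Naturality

open SketchSpace DirectedSet

variable {C : Type w} [Category.{u} C] [HasLimits C] {D : Type w'} [Category.{u} D] [HasLimits D]

lemma map_netInclusion (M : SketchSpace.{u}ᵒᵖ ⥤ C) (H : C ⥤ D) (P : DirectedSet.{u}) :
    H.map (LimitSketch.IsModel.netInclusion M P) ≫ TopObj.cmp H (M.obj (op one)) P =
      LimitSketch.IsModel.netInclusion (M ⋙ H) P := by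
  refine TopObj.netPow_hom_ext (fun p => ?_) ?_
  · rw [Category.assoc, TopObj.cmp_term, ← H.map_comp, LimitSketch.IsModel.netInclusion,
      LimitSketch.IsModel.netInclusion, TopObj.lift_term]
    exact (TopObj.lift_term (fun p : P => H.map (M.map (pt (withInfty P) (term p)).op)) _ p).symm
  · rw [Category.assoc, TopObj.cmp_limit, ← H.map_comp, LimitSketch.IsModel.netInclusion,
      LimitSketch.IsModel.netInclusion, TopObj.lift_limit]
    exact (TopObj.lift_limit (fun p : P => H.map (M.map (pt (withInfty P) (term p)).op)) _).symm

end Naturality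

section

variable {C : Type w} [Category.{u} C] [HasLimits C] {D : Type w} [Category.{u} D] [HasLimits D]

/-- The construction of topological space objects from models commutes with continuous functors.
The components of the isomorphism are identities on the underlying objects. -/
noncomputable def modToTopObjCompMap (H : C ⥤ D) [PreservesLimits H] :
    modToTopObj.{u} C ⋙ TopObj.map H ≅ topSketch.{u}.mapMod H ⋙ modToTopObj.{u} D :=
  NatIso.ofComponents (fun M => TopObj.mkIso (Iso.refl (H.obj (M.obj.obj (op SketchSpace.one))))
    fun T P x s => by
      refine Iff.trans ?_ (iff_of_eq (congrArg₂ (ConvergenceClass.conv _ P)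
        (funext fun p => (Category.comp_id (x p)).symm) (Category.comp_id s).symm))
      exact iff_of_eq (congrArg (fun ι => NetFactors ι x s) (map_netInclusion M.obj H P)))
    fun φ => TopObj.Hom.ext ((Category.comp_id _).trans (Category.id_comp _).symm)

end

/-! ### Spaces as models -/

section Nerve

open Filter Topology SketchSpace DirectedSet

/-- The directed set of neighborhoods of a point. -/
abbrev nhdsDirectedSet {Y : Type u} [TopologicalSpace Y] (y : Y) : DirectedSet.{u} where
  carrier := {U : Set Y // U ∈ 𝓝 y}ᵒᵈ
  directed := ⟨fun U V =>
    ⟨OrderDual.toDual ⟨_, inter_mem (OrderDual.ofDual U).2 (OrderDual.ofDual V).2⟩,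
    Set.inter_subset_left, Set.inter_subset_right⟩⟩
  nonempty := ⟨OrderDual.toDual ⟨_, univ_mem⟩⟩

/-- Continuity can be tested on nets that are indexed by the neighborhoods of their limits. -/
lemma continuous_of_tendsto_nhdsDirectedSet {Y Z : Type u} [TopologicalSpace Y]
    [TopologicalSpace Z] {g : Y → Z} (h : ∀ (y : Y) (x : nhdsDirectedSet y → Y),
      Tendsto x atTop (𝓝 y) → Tendsto (fun U => g (x U)) atTop (𝓝 (g y))) : Continuous g := by
  refine continuous_iff_continuousAt.2 fun y => tendsto_def.2 fun V hV => ?_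
  by_contra hn
  -- Choose a point in each neighborhood of `y` that witnesses the discontinuity at `y`.
  have hx : ∀ U : nhdsDirectedSet y, ∃ z ∈ (OrderDual.ofDual U).1, g z ∉ V := fun U => by
    by_contra! hU
    exact hn (mem_of_superset (OrderDual.ofDual U).2 hU)
  choose x hxU hxV using hx
  have hx : Tendsto x atTop (𝓝 y) := tendsto_def.2 fun U hU =>
    mem_of_superset (mem_atTop (α := nhdsDirectedSet y) (OrderDual.toDual ⟨U, hU⟩))
      fun W hW => hW (hxU W)
  have := (nhdsDirectedSet y).directed
  have := (nhdsDirectedSet y).nonempty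
  obtain ⟨U, hU⟩ := ((h y x hx).eventually_mem hV).exists
  exact hxV U hU

/-- The functor that maps a space to the model of continuous maps to it. -/
def topNerve : TopCat.{u} ⥤ topSketch.{u}.Mod (Type u) where
  obj Y := ⟨nerveObj Y, isModel_nerveObj Y⟩
  map f := ObjectProperty.homMk (Functor.whiskerLeft IsSketchSpace.ι.op (yoneda.map f))
  map_id Y := by ext; exact Category.comp_id _
  map_comp f g := by ext; exact (Category.assoc _ _ _).symm

instance : topNerve.{u}.Faithful where
  map_injective {Y Z} f g h := TopCat.ext fun y => by
    have h' := ConcreteCategory.congr_hom (NatTrans.congr_app (congrArg InducedCategory.Hom.hom h)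
      (op one)) (fromDiscrete (X := Y) fun _ => y)
    exact ConcreteCategory.congr_hom (C := TopCat) h' PUnit.unit

/-- A natural transformation between nerves is composition with a map of points `g`, and `g` is
continuous since composition with it preserves continuity on the spaces `P ∪ {∞}`. -/
instance : topNerve.{u}.Full where
  map_surjective {Y Z} φ := by
    let g (y : Y) : Z := TopCat.Hom.hom (X := one.obj) (Y := Z)
      (φ.hom.app (op one) (fromDiscrete (X := Y) fun _ => y)) PUnit.unit
    have hg {A : SketchSpace.{u}} (f : A.obj ⟶ Y) (a : A.obj) :
        TopCat.Hom.hom (X := A.obj) (Y := Z) (φ.hom.app (op A) f) a = g (f a) :=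
      (ConcreteCategory.congr_hom (C := TopCat) (ConcreteCategory.congr_hom
        (φ.hom.naturality (pt A a).op) f) PUnit.unit).symm
    have hc : Continuous g := continuous_of_tendsto_nhdsDirectedSet fun y x hx => by
      let f : (nhdsDirectedSet y).withInfty ⟶ Y :=
        TopCat.ofHom (X := (nhdsDirectedSet y).withInfty)
          ⟨extend x y, continuous_withInfty_iff.2 hx⟩
      have hf := (TopCat.Hom.hom (X := (nhdsDirectedSet y).withInfty) (Y := Z)
        (φ.hom.app (op (withInfty _)) f)).continuous
      exact continuous_withInfty_iff.1 (hf.congr (hg (A := withInfty (nhdsDirectedSet y)) f))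
    refine ⟨TopCat.ofHom ⟨g, hc⟩, InducedCategory.hom_ext (NatTrans.ext (funext fun A => ?_))⟩
    ext f
    exact TopCat.ext fun a => (hg (A := A.unop) f a).symm

/-- A set-valued model is isomorphic to the nerve of the space of generalized elements with domain
`PUnit` of its topological space object. -/
instance : topNerve.{u}.EssSurj where
  mem_essImage M := by
    let A := M.property.toTopObj
    let e : (⟨A.toFunctor, A.isModel_toFunctor⟩ : topSketch.{u}.Mod (Type u)) ≅ M :=
      (modToTopObj (Type u)).preimageIso A.nonempty_iso.some
    -- Evaluate the representing property of `toFunctor` at the domain `PUnit`.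
    let i : nerveObj (A.elements.obj (op PUnit)) ≅ A.toFunctor :=
      (Functor.isoWhiskerRight A.toFunctorIso ((evaluation _ _).obj (op PUnit))).symm ≪≫
        Functor.isoWhiskerLeft A.toFunctor Coyoneda.punitIso ≪≫ A.toFunctor.rightUnitor
    let i' : topNerve.obj (A.elements.obj (op PUnit)) ≅ ⟨A.toFunctor, A.isModel_toFunctor⟩ :=
      (topSketch.IsModel (Type u)).isoMk i
    exact ⟨_, ⟨i' ≪≫ e⟩⟩

instance : topNerve.{u}.IsEquivalence where

/-- The value of a nerve at the one-point space. -/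
def nerveCompEvaluation :
    topNerve.{u} ⋙ topSketch.{u}.evaluation (op one) (Type u) ≅ CategoryTheory.forget TopCat.{u} :=
  NatIso.ofComponents (fun Y => Equiv.toIso
    { toFun := fun f => TopCat.Hom.hom (X := one.obj) (Y := Y) f PUnit.unit
      invFun := fun y => fromDiscrete (X := Y) fun _ => y
      left_inv := fun _ => rfl
      right_inv := fun _ => rfl }) fun _ => rfl

/-! ### Spaces as small colimits of sketch spaces -/

variable (Y : TopCat.{u})

/-- The one-point space and the spaces `P ∪ {∞}` for the directed sets `P` of neighborhoods of
points of `Y`. -/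
def nhdsSpace : Option Y → SketchSpace.{u}
  | none => one
  | some y => withInfty (nhdsDirectedSet y)

/-- The inclusion of the small category of the spaces `nhdsSpace` into the category of spaces. -/
abbrev nhdsSpaceInclusion : InducedCategory SketchSpace.{u} (nhdsSpace Y) ⥤ TopCat.{u} :=
  inducedFunctor (nhdsSpace Y) ⋙ IsSketchSpace.ι

/-- The small category of the spaces `nhdsSpace` over `Y`. -/
abbrev NhdsSpaceOver : Type u := CostructuredArrow (nhdsSpaceInclusion Y) Y

namespace NhdsSpaceOver

/-- The diagram of the spaces `nhdsSpace` over `Y`. -/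
abbrev diagram : NhdsSpaceOver Y ⥤ TopCat.{u} :=
  CostructuredArrow.proj (nhdsSpaceInclusion Y) Y ⋙ nhdsSpaceInclusion Y

variable {Y}

/-- A continuous map from one of the spaces `nhdsSpace`, as an object over `Y`. -/
abbrev mk (o : Option Y) (f : (nhdsSpace Y o).obj ⟶ Y) : NhdsSpaceOver Y :=
  CostructuredArrow.mk (C := InducedCategory SketchSpace (nhdsSpace Y)) (S := nhdsSpaceInclusion Y)
    (Y := o) f

/-- A point of `Y`, as an object over `Y`. -/
abbrev point (y : Y) : NhdsSpaceOver Y := mk none (fromDiscrete (X := Y) fun _ => y)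

/-- The underlying map of the morphism from `Y` that is induced by a cocone. -/
def descFun (t : Cocone (diagram Y)) (y : Y) : t.pt :=
  TopCat.Hom.hom (X := one.obj) (Y := t.pt) (t.ι.app (point y)) PUnit.unit

/-- The points of a space over `Y` are morphisms over `Y` from points of `Y`. -/
lemma ι_app_eq_descFun (t : Cocone (diagram Y)) (o : Option Y) (f : (nhdsSpace Y o).obj ⟶ Y)
    (a : (nhdsSpace Y o).obj) :
    TopCat.Hom.hom (X := (nhdsSpace Y o).obj) (Y := t.pt) (t.ι.app (mk o f)) a =
      descFun t (f a) := by
  let g : point (f a) ⟶ mk o f :=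
    CostructuredArrow.homMk (InducedCategory.homMk (pt (nhdsSpace Y o) a)) rfl
  exact ConcreteCategory.congr_hom (C := TopCat) (t.w g) PUnit.unit

lemma continuous_descFun (t : Cocone (diagram Y)) : Continuous (descFun t) :=
  continuous_of_tendsto_nhdsDirectedSet fun y x hx => by
    -- The convergent net is an object over `Y`, and its component of the cocone is continuous.
    let f : (nhdsDirectedSet y).withInfty ⟶ Y :=
      TopCat.ofHom (X := (nhdsDirectedSet y).withInfty)
        ⟨extend x y, continuous_withInfty_iff.2 hx⟩
    have hf := (TopCat.Hom.hom (X := (nhdsDirectedSet y).withInfty) (Y := t.pt)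
      (t.ι.app (mk (some y) f))).continuous
    exact continuous_withInfty_iff.1 (hf.congr (ι_app_eq_descFun t (some y) f))

variable (Y) in
/-- A space is the colimit of the one-point spaces and the spaces `P ∪ {∞}` over it, where `P`
runs through the directed sets of neighborhoods of its points. -/
def presentation : ColimitPresentation (NhdsSpaceOver Y) Y where
  diag := diagram Y
  ι := { app := fun j => j.hom
         naturality := fun _ _ f => f.w }
  isColimit :=
    { desc := fun t => TopCat.ofHom ⟨descFun t, continuous_descFun t⟩
      fac := fun t j => TopCat.ext fun a => (ι_app_eq_descFun t j.left j.hom a).symm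
      uniq := fun _ _ hm => TopCat.ext fun y =>
        ConcreteCategory.congr_hom (C := TopCat) (hm (point y)) PUnit.unit }

end NhdsSpaceOver

/-- The colimit presentation of the space of a set-valued model gives one of the model. -/
lemma topSketch_isSmallModel (M : topSketch.{u}.Mod (Type u)) : topSketch.{u}.IsSmallModel M :=
  ⟨_, _, ((NhdsSpaceOver.presentation (topNerve.objPreimage M)).map topNerve).ofIso
    (topNerve.objObjPreimageIso M),
    fun j => .mk' (coyonedaIsoNerve (nhdsSpace (topNerve.objPreimage M) j.left))⟩

end Nerve

theorem theorem8p2 :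
    topSketch.{u}.Realized ∧
    ¬ EssentiallySmall.{u} SketchSpace.{u}ᵒᵖ ∧
    (∃ (Φ : ∀ (C : Type w) [Category.{u} C] [HasLimits C], topSketch.{u}.Mod C ≌ TopObj C)
      (η : ∀ (C : Type w) [Category.{u} C] [HasLimits C],
        (Φ C).functor ⋙ TopObj.forget C ≅ topSketch.{u}.evaluation (op SketchSpace.one) C),
      ∀ (C D : Type w) [Category.{u} C] [Category.{u} D] [HasLimits C] [HasLimits D]
        (H : C ⥤ D) [PreservesLimits H],
        ∃ α : (Φ C).functor ⋙ TopObj.map H ≅ topSketch.{u}.mapMod H ⋙ (Φ D).functor,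
          ∀ M : topSketch.{u}.Mod C,
            (TopObj.forget D).map (α.hom.app M) ≫ (η D).hom.app ((topSketch.{u}.mapMod H).obj M) =
              H.map ((η C).hom.app M)) ∧
    (∃ Ψ : topSketch.{u}.Mod (Type u) ≌ TopCat.{u},
      Nonempty (Ψ.functor ⋙ CategoryTheory.forget TopCat.{u} ≅
        topSketch.{u}.evaluation (op SketchSpace.one) (Type u))) ∧
    ∀ M : topSketch.{u}.Mod (Type u), topSketch.{u}.IsSmallModel M := by
  refine ⟨topSketch_realized, not_essentiallySmall_sketchSpace,
    ⟨fun C _ _ => (modToTopObj C).asEquivalence, fun C _ _ => Iso.refl _,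
      fun C D _ _ _ _ H _ => ⟨modToTopObjCompMap H, fun M => ?_⟩⟩,
    ⟨topNerve.asEquivalence.symm, ⟨?_⟩⟩, topSketch_isSmallModel⟩
  · exact (Category.id_comp _).trans (H.map_id _).symm
  · exact Functor.isoWhiskerLeft _ nerveCompEvaluation.symm ≪≫
      (Functor.associator _ _ _).symm ≪≫
      Functor.isoWhiskerRight topNerve.asEquivalence.counitIso _ ≪≫ Functor.leftUnitor _
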